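/- Let $k$ be a field of characteristic zero, let $K\supseteq k$ be an algebraically closed extension field (for instance $K=k$ if $k$ is algebraically closed), and let $I\subsetneq k[x_1,\dots,x_n]$ be a proper binomial ideal, i.e. a proper ideal generated by polynomials with at most two terms. **Definitions.** A proper binomial ideal $J$ is *cellular* if each variable is either a nonzerodivisor or nilpotent modulo $J$; let $\mathcal E$ be the set of indices of the variables that are nonzerodivisors modulo $J$ (the cell indices), and put $M(\mathcal E)=\langle x_i : i\notin\mathcal E\rangle$ and $k[\mathcal E]=k[x_i:i\in\mathcal E]$. A *partial character* on $\mathbb Z^{\mathcal E}$ over $k$ is a subgroup $\mathcal L\subseteq\mathbb Z^{\mathcal E}$ together with a homomorphism $\sigma:\mathcal L\to k^*$; its *lattice ideal* is $I_+(\sigma)=\langle x^{m^+}-\sigma(m)x^{m^-} : m\in\mathcal L\rangle\subseteq k[\mathcal E]$, where $m=m^+-m^-$ is the decomposition into positive and negative part. A *saturation* of $\sigma$ over $K$ is a homomorphism $\tau:\mathrm{Sat}(\mathcal L)\to K^*$ that extends $\sigma$, where $\mathrm{Sat}(\mathcal L)=\{m\in\mathbb Z^{\mathcal E} : dm\in\mathcal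 L\text{ for some } 0\ne d\in\mathbb Z\}$. The notation $M(\mathcal E)+I_+(\sigma)$ stands for the ideal generated in the polynomial ring in all variables. **Algorithm.** Maintain a finite multiset of pending ideals of $k[x_1,\dots,x_n]$, initially $\{I\}$, and a set of saved ideals of $K[x_1,\dots,x_n]$, initially empty. While some ideal is pending, take any pending ideal $J$ and remove it from the multiset. * If $J$ is cellular with cell indices $\mathcal E$, let $\sigma$ be the partial character with $J\cap k[\mathcal E]=I_+(\sigma)$, and save the ideals $P(\tau)=M(\mathcal E)+I_+(\tau)\subseteq K[x_1,\dots,x_n]$ for all saturations $\tau$ of $\sigma$ over $K$. * If $J$ is not cellular, choose any variable $x_i$ that is a zerodivisor but not nilpotent modulo $J$, and add $J+\langle x_i\rangle$ and $(J:x_i^\infty)$ to the pending ideals. When no ideal is pending, remove the redundant saved ideals (those that properly contain another saved ideal) and output the remaining ones. **Theorem (termination and correctness).** Whatever choices are made: 1. There is no infinite run, and the algorithm never gets stuck while an ideal is pending. More precisely, each pending ideal $J$ that ever occurs is a proper binomial ideal; if $J$ is not cellular, a variable as required exists; if $J$ is cellular, the partial character $\sigma$ with $J\cap k[\mathcal E]=I_+(\sigma)$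 exists and is unique, and $\mathrm{Rad}(J)=M(\mathcal E)+I_+(\sigma)$. 2. At each time only finitely many ideals have been saved, and all of them are binomial prime ideals of $K[x_1,\dots,x_n]$. 3. The output of every completed run is exactly the set of minimal primes of $I\,K[x_1,\dots,x_n]$. The intersection of the output is $\mathrm{Rad}(I\,K[x_1,\dots,x_n])=\mathrm{Rad}(I)\,K[x_1,\dots,x_n]$, and it changes if any one of the output ideals is omitted; so the output is the minimal prime decomposition of the radical, and it consists of binomial ideals. -/

import Mathlib

namespace BinomialMinPrimes

open MvPolynomial

section Ideals

variable {ι k : Type*} [Field k]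

/-- A binomial is a polynomial with at most two terms (so monomials and `0` are allowed). -/
def IsBinomial (f : MvPolynomial ι k) : Prop := f.support.card ≤ 2

/-- A binomial ideal is an ideal generated by binomials. -/
def IsBinomialIdeal (I : Ideal (MvPolynomial ι k)) : Prop :=
  ∃ B : Set (MvPolynomial ι k), (∀ f ∈ B, IsBinomial f) ∧ I = Ideal.span B

/-- The variable `x i` is a nonzerodivisor modulo `I`. -/
def IsNonzerodivisorVar (I : Ideal (MvPolynomial ι k)) (i : ι) : Prop :=
  Ideal.Quotient.mk I (X i) ∈ nonZeroDivisors (MvPolynomial ι k ⧸ I)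

/-- The variable `x i` is nilpotent modulo `I`. -/
def IsNilpotentVar (I : Ideal (MvPolynomial ι k)) (i : ι) : Prop :=
  IsNilpotent (Ideal.Quotient.mk I (X i))

/-- A cellular ideal: a proper binomial ideal modulo which each variable is either a
nonzerodivisor or nilpotent. -/
structure IsCellular (I : Ideal (MvPolynomial ι k)) : Prop where
  binomial : IsBinomialIdeal I
  ne_top : I ≠ ⊤
  cell : ∀ i, IsNonzerodivisorVar I i ∨ IsNilpotentVar I i

/-- The cell indices `𝓔` of `I`: the variables that are nonzerodivisors modulo `I`. -/
def cellIndices (I : Ideal (MvPolynomial ι k)) : Set ι := {i | IsNonzerodivisorVar I i}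

/-- The ideal `(I : f^∞)`. -/
def saturation (I : Ideal (MvPolynomial ι k)) (f : MvPolynomial ι k) :
    Ideal (MvPolynomial ι k) where
  carrier := {g | ∃ s : ℕ, g * f ^ s ∈ I}
  zero_mem' := ⟨0, by simp⟩
  add_mem' := by
    rintro a b ⟨s, hs⟩ ⟨t, ht⟩
    refine ⟨s + t, ?_⟩
    have h : (a + b) * f ^ (s + t) = f ^ t * (a * f ^ s) + f ^ s * (b * f ^ t) := by ring
    rw [h]
    exact I.add_mem (I.mul_mem_left _ hs) (I.mul_mem_left _ ht)
  smul_mem' := by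
    rintro c a ⟨s, hs⟩
    refine ⟨s, ?_⟩
    rw [smul_eq_mul, mul_assoc]
    exact I.mul_mem_left _ hs

/-- `I ∩ k[𝓔]`, as an ideal of the polynomial ring `k[𝓔]` in the variables of index in `𝓔`. -/
noncomputable def restrictTo (𝓔 : Set ι) (I : Ideal (MvPolynomial ι k)) :
    Ideal (MvPolynomial 𝓔 k) :=
  I.comap (rename ((↑) : 𝓔 → ι))

/-- The ideal of `k[x]` generated by an ideal of `k[𝓔]`. -/
noncomputable def extendFrom (𝓔 : Set ι) (J : Ideal (MvPolynomial 𝓔 k)) :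
    Ideal (MvPolynomial ι k) :=
  J.map (rename ((↑) : 𝓔 → ι))

variable (k) in
/-- `M(𝓔)`, the ideal generated by the variables with index outside `𝓔`. -/
noncomputable def nonCellIdeal (𝓔 : Set ι) : Ideal (MvPolynomial ι k) :=
  Ideal.span {f | ∃ i, i ∉ 𝓔 ∧ f = X i}

end Ideals

section Characters

variable {ι : Type*}

/-- A partial character `(𝓛, σ)`: a lattice `𝓛 ⊆ ℤ^ι` with a homomorphism `σ : 𝓛 → k^*`. -/
structure PartialCharacter (k ι : Type*) [Field k] where
  lattice : AddSubgroup (ι → ℤ)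
  char : Multiplicative lattice →* kˣ

/-- `Sat(𝓛)`: the vectors with a nonzero integer multiple in `𝓛`. -/
def satLattice (L : AddSubgroup (ι → ℤ)) : AddSubgroup (ι → ℤ) where
  carrier := {m | ∃ d : ℤ, d ≠ 0 ∧ d • m ∈ L}
  zero_mem' := ⟨1, one_ne_zero, by simp⟩
  add_mem' := by
    rintro a b ⟨d, hd, ha⟩ ⟨e, he, hb⟩
    refine ⟨d * e, mul_ne_zero hd he, ?_⟩
    rw [smul_add]
    refine L.add_mem ?_ ?_
    · rw [mul_comm, mul_smul]
      exact L.zsmul_mem ha e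
    · rw [mul_smul]
      exact L.zsmul_mem hb d
  neg_mem' := by
    rintro a ⟨d, hd, ha⟩
    exact ⟨d, hd, by rw [smul_neg]; exact L.neg_mem ha⟩

/-- The partial character over an extension field `K` of `k` with the same lattice and the
same values. -/
def PartialCharacter.baseChange {k : Type*} [Field k] (σ : PartialCharacter k ι)
    (K : Type*) [Field K] [Algebra k K] : PartialCharacter K ι where
  lattice := σ.lattice
  char := (Units.map (algebraMap k K : k →* K)).comp σ.char

/-- `τ` is a saturation of `σ`: its lattice is the saturation of the lattice of `σ`, and it
restricts to `σ`. -/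
def PartialCharacter.IsSaturationOf {k : Type*} [Field k] (τ σ : PartialCharacter k ι) : Prop :=
  τ.lattice = satLattice σ.lattice ∧
    ∀ (m : ι → ℤ) (hσ : m ∈ σ.lattice) (hτ : m ∈ τ.lattice),
      τ.char (Multiplicative.ofAdd ⟨m, hτ⟩) = σ.char (Multiplicative.ofAdd ⟨m, hσ⟩)

/-- The monomial `x^(m⁺)`, where `m⁺` is the positive part of the integer vector `m`. -/
noncomputable def posMonomial (k : Type*) [Field k] [Finite ι] (m : ι → ℤ) :
    MvPolynomial ι k :=
  monomial (Finsupp.equivFunOnFinite.symm fun i => (m i).toNat) 1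

/-- The lattice ideal `I₊(σ) = ⟨x^(m⁺) - σ(m) x^(m⁻) : m ∈ 𝓛⟩`; here `m⁻ = (-m)⁺`. -/
noncomputable def PartialCharacter.latticeIdeal {k : Type*} [Field k] [Finite ι]
    (σ : PartialCharacter k ι) : Ideal (MvPolynomial ι k) :=
  Ideal.span {f | ∃ m : σ.lattice, f = posMonomial k (m : ι → ℤ) -
    C ((σ.char (Multiplicative.ofAdd m) : kˣ) : k) * posMonomial k (-(m : ι → ℤ))}

/-- `M(𝓔) + I₊(σ)`, for a partial character `σ` on `ℤ^𝓔`. -/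
noncomputable def cellIdeal {k : Type*} [Field k] [Finite ι] (𝓔 : Set ι)
    (σ : PartialCharacter k 𝓔) : Ideal (MvPolynomial ι k) :=
  nonCellIdeal k 𝓔 ⊔ extendFrom 𝓔 σ.latticeIdeal

end Characters

section Algorithm

/-- A state of the algorithm: the ideals still to be processed, and the ideals saved so far.
Pending ideals have coefficients in `k`, saved ones in the extension field `K`, in which
saturations are computed. -/
structure State (k K : Type*) [Field k] [Field K] (n : ℕ) where
  pending : Multiset (Ideal (MvPolynomial (Fin n) k))
  collected : Set (Ideal (MvPolynomial (Fin n) K))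

variable {k : Type*} [Field k] {n : ℕ}

/-- The initial state on input `I`. -/
def initial (K : Type*) [Field K] (I : Ideal (MvPolynomial (Fin n) k)) : State k K n where
  pending := {I}
  collected := ∅

variable {K : Type*} [Field K] [Algebra k K]

/-- One step of the algorithm. It processes any one of the pending ideals, `J`.
* If `J` is cellular with cell indices `𝓔`, let `σ` be the partial character with
  `J ∩ k[𝓔] = I₊(σ)`; save the ideals `M(𝓔) + I₊(τ)` for all saturations `τ` of `σ` over `K`.
* If not, choose any variable `x i` that is a zerodivisor but not nilpotent modulo `J`, and
  replace `J` by the two ideals `J + ⟨x i⟩` and `(J : (x i)^∞)`. -/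
inductive Step : State k K n → State k K n → Prop
  | cellular (J : Ideal (MvPolynomial (Fin n) k))
      (W : Multiset (Ideal (MvPolynomial (Fin n) k)))
      (S : Set (Ideal (MvPolynomial (Fin n) K)))
      (σ : PartialCharacter k (cellIndices J))
      (hJ : IsCellular J) (hσ : restrictTo (cellIndices J) J = σ.latticeIdeal) :
      Step ⟨J ::ₘ W, S⟩
        ⟨W, S ∪ {P | ∃ τ : PartialCharacter K (cellIndices J),
          τ.IsSaturationOf (σ.baseChange K) ∧ P = cellIdeal (cellIndices J) τ}⟩
  | split (J : Ideal (MvPolynomial (Fin n) k))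
      (W : Multiset (Ideal (MvPolynomial (Fin n) k)))
      (S : Set (Ideal (MvPolynomial (Fin n) K))) (i : Fin n)
      (hJ : ¬ IsCellular J) (hzd : ¬ IsNonzerodivisorVar J i) (hnil : ¬ IsNilpotentVar J i) :
      Step ⟨J ::ₘ W, S⟩
        ⟨(J ⊔ Ideal.span {X i}) ::ₘ saturation J (X i) ::ₘ W, S⟩

/-- `s` is reached at some point of some run of the algorithm on input `I`. -/
def Reachable (I : Ideal (MvPolynomial (Fin n) k)) (s : State k K n) : Prop :=
  Relation.ReflTransGen Step (initial K I) s

/-- The output at a final state: the saved ideals, after removal of the redundant ones (those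
that properly contain another saved ideal). -/
def State.output (s : State k K n) : Set (Ideal (MvPolynomial (Fin n) K)) :=
  {P | P ∈ s.collected ∧ ∀ Q ∈ s.collected, Q ≤ P → Q = P}

end Algorithm

end BinomialMinPrimes

/-! A prime contains `J` iff it contains `J + ⟨x_i⟩` or `(J : x_i^∞)`. If `x_i` is a zerodivisor but
not nilpotent modulo a binomial ideal `J`, both ideals are proper, strictly larger and again
binomial. A step thus trades a pending ideal for at most two larger ones, and termination is
well-foundedness of the multiset order over a Noetherian ring (`Step.cutExpand`). Correctness is an
invariant: the primes of `K[x]` containing `I` are those containing a pending or a saved ideal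
(`Step.covers_iff`).

The cellular step carries the algebra, and linear forms on monomials are the main tool. They
characterise binomial ideals by a condition on supports (`IsBinomialIdeal.binomialSpanned`), which
passes to saturations and to `J ∩ k[𝓔]`, and they cut out lattice ideals: `f ∈ I₊(σ)` iff `∑ f_w σ(w
- u) = 0` for all `u`, with `σ` extended by zero (`PartialCharacter.mem_latticeIdeal_iff`). For
cellular `J`, the variables of `k[𝓔]` cancel modulo `J ∩ k[𝓔]`, so this is a lattice ideal `I₊(σ)`;
the other variables are nilpotent, and `J ⊆ M(𝓔) + I₊(σ) ⊆ Rad(J)`.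

Over an algebraically closed field of characteristic zero, orthogonality of characters makes the
forms of `σ` averages of those of its finitely many saturations `τ`. So `I₊(σ)` is the intersection
of the `I₊(τ)`, each of which is prime as the kernel of a map to the group algebra of a torsion-free
group. Hence `M(𝓔) + I₊(σ)` is radical, and a prime containing it contains some `P(τ)`. Radicality
over `k` follows by contraction from the algebraic closure. Extension of scalars commutes with
finite intersections, which gives `Rad(I) K[x] = Rad(I K[x])`. -/

namespace BinomialMinPrimes

open MvPolynomial

/-! ### Binomial ideals via supports. -/

section BinomialCriterion

variable {ι k : Type*} [Field k]

/-- The linear form on polynomials that takes the monomial of exponent `u` to `g u`. -/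
noncomputable def pairing (g : (ι →₀ ℕ) → k) : MvPolynomial ι k →ₗ[k] k :=
  (basisMonomials ι k).constr k g

@[simp]
theorem pairing_monomial (g : (ι →₀ ℕ) → k) (u : ι →₀ ℕ) (a : k) :
    pairing g (monomial u a) = a * g u := by
  have h : monomial u a = a • basisMonomials ι k u := by simp [smul_monomial]
  rw [h, map_smul, pairing, Module.Basis.constr_basis, smul_eq_mul]

theorem pairing_eq_sum (g : (ι →₀ ℕ) → k) (f : MvPolynomial ι k) :
    pairing g f = ∑ u ∈ f.support, f.coeff u * g u := by
  conv_lhs => rw [f.as_sum, map_sum]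
  simp

/-- A linear form vanishes on an ideal if it vanishes on the monomial multiples of the
generators. -/
theorem pairing_eq_zero_of_mem_span {g : (ι →₀ ℕ) → k} {B : Set (MvPolynomial ι k)}
    (h : ∀ b ∈ B, ∀ w, pairing g (monomial w 1 * b) = 0) {f : MvPolynomial ι k}
    (hf : f ∈ Ideal.span B) : pairing g f = 0 := by
  suffices ∀ p, pairing g (p * f) = 0 by simpa using this 1
  induction hf using Submodule.span_induction with
  | mem b hb =>
    intro p
    induction p using MvPolynomial.induction_on' with
    | monomial w a =>
      have : monomial w a * b = a • (monomial w 1 * b) := by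
        rw [← smul_mul_assoc, smul_monomial, smul_eq_mul, mul_one]
      rw [this, map_smul, h b hb, smul_zero]
    | add p q hp hq => rw [add_mul, map_add, hp, hq, add_zero]
  | zero => simp
  | add x y _ _ hx hy => intro p; rw [mul_add, map_add, hx, hy, add_zero]
  | smul a x _ hx => intro p; rw [smul_eq_mul, ← mul_assoc, hx]

/-- The subspace `N` is spanned by binomials, expressed in terms of supports: each monomial of an
element of `N` lies in `N`, or is congruent modulo `N` to a multiple of another monomial of the
same element. -/
def BinomialSpanned (N : Submodule k (MvPolynomial ι k)) : Prop :=
  ∀ f ∈ N, ∀ u ∈ f.support, monomial u 1 ∈ N ∨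
    ∃ v ∈ f.support, v ≠ u ∧ ∃ c : k, monomial u 1 - monomial v c ∈ N

theorem support_sub_monomial_ssubset {f : MvPolynomial ι k} {u v : ι →₀ ℕ} (hu : u ∈ f.support)
    (hv : v ∈ f.support) (huv : v ≠ u) (c : k) :
    (f - C (f.coeff u) * (monomial u 1 - monomial v c)).support ⊂ f.support := by
  classical
  refine Finset.ssubset_iff_of_subset ?_ |>.2 ⟨u, hu, ?_⟩
  · intro w hw
    by_contra hwf
    have h1 : u ≠ w := fun h => hwf (h ▸ hu)
    have h2 : v ≠ w := fun h => hwf (h ▸ hv)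
    rw [mem_support_iff] at hw
    rw [notMem_support_iff] at hwf
    simp [coeff_C_mul, coeff_monomial, h1, h2, hwf] at hw
  · simp [coeff_C_mul, coeff_monomial, huv]

theorem support_sub_monomial_ssubset' {f : MvPolynomial ι k} {u : ι →₀ ℕ} (hu : u ∈ f.support) :
    (f - C (f.coeff u) * monomial u 1).support ⊂ f.support := by
  classical
  refine Finset.ssubset_iff_of_subset ?_ |>.2 ⟨u, hu, ?_⟩
  · intro w hw
    by_contra hwf
    have h1 : u ≠ w := fun h => hwf (h ▸ hu)
    rw [mem_support_iff] at hw
    rw [notMem_support_iff] at hwf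
    simp [coeff_C_mul, coeff_monomial, h1, hwf] at hw
  · simp [coeff_C_mul, coeff_monomial]

/-- Subtracting a suitable multiple of a binomial of `N` removes `u` from the support and adds
nothing, so induction on the support applies. -/
theorem BinomialSpanned.le {N Q : Submodule k (MvPolynomial ι k)} (hN : BinomialSpanned N)
    (h : ∀ u v c, monomial u 1 - monomial v c ∈ N → monomial u 1 - monomial v c ∈ Q) :
    N ≤ Q := by
  suffices ∀ (s : Finset (ι →₀ ℕ)) (f : MvPolynomial ι k), f.support = s → f ∈ N → f ∈ Q from
    fun f hf => this _ f rfl hf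
  intro s
  induction s using Finset.strongInduction with
  | H s ih =>
    rintro f rfl hf
    rcases f.support.eq_empty_or_nonempty with h0 | ⟨u, hu⟩
    · rw [support_eq_empty] at h0
      simp [h0]
    · rcases hN f hf u hu with hm | ⟨v, hv, hvu, c, hc⟩
      · have h1 : f - C (f.coeff u) * monomial u 1 ∈ Q := by
          refine ih _ (support_sub_monomial_ssubset' hu) _ rfl ?_
          rw [← smul_eq_C_mul]
          exact N.sub_mem hf (N.smul_mem _ hm)
        have h2 : C (f.coeff u) * monomial u 1 ∈ Q := by
          rw [← smul_eq_C_mul]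
          -- A monomial is the case `c = 0` of the binomials in `h`.
          have := h u u 0 (by simpa using hm)
          exact Q.smul_mem _ (by simpa using this)
        simpa using Q.add_mem h1 h2
      · have h1 : f - C (f.coeff u) * (monomial u 1 - monomial v c) ∈ Q := by
          refine ih _ (support_sub_monomial_ssubset hu hv hvu c) _ rfl ?_
          rw [← smul_eq_C_mul]
          exact N.sub_mem hf (N.smul_mem _ hc)
        have h2 : C (f.coeff u) * (monomial u 1 - monomial v c) ∈ Q := by
          rw [← smul_eq_C_mul]
          exact Q.smul_mem _ (h u v c hc)
        simpa using Q.add_mem h1 h2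

theorem isBinomial_monomial (u : ι →₀ ℕ) (a : k) : IsBinomial (monomial u a) :=
  (Finset.card_le_card support_monomial_subset).trans (by simp)

theorem isBinomial_monomial_sub_monomial (u v : ι →₀ ℕ) (a b : k) :
    IsBinomial (monomial u a - monomial v b) := by
  classical
  refine (Finset.card_le_card (support_sub _ _ _)).trans ((Finset.card_union_le _ _).trans ?_)
  have h1 : (monomial u a).support.card ≤ 1 :=
    (Finset.card_le_card support_monomial_subset).trans (by simp)
  have h2 : (monomial v b).support.card ≤ 1 :=
    (Finset.card_le_card support_monomial_subset).trans (by simp)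
  omega

theorem IsBinomial.exists_eq {f : MvPolynomial ι k} (hf : IsBinomial f) :
    ∃ u v a b, f = monomial u a + monomial v b := by
  classical
  unfold IsBinomial at hf
  interval_cases h : f.support.card
  · rw [Finset.card_eq_zero, support_eq_empty] at h
    exact ⟨0, 0, 0, 0, by simp [h]⟩
  · obtain ⟨u, hu⟩ := Finset.card_eq_one.1 h
    refine ⟨u, u, f.coeff u, 0, ?_⟩
    conv_lhs => rw [f.as_sum, hu]
    simp
  · obtain ⟨u, v, huv, hs⟩ := Finset.card_eq_two.1 h
    refine ⟨u, v, f.coeff u, f.coeff v, ?_⟩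
    conv_lhs => rw [f.as_sum, hs]
    rw [Finset.sum_pair huv]

theorem isBinomialIdeal_of_binomialSpanned {J : Ideal (MvPolynomial ι k)}
    (hJ : BinomialSpanned (J.restrictScalars k)) : IsBinomialIdeal J := by
  refine ⟨{f | IsBinomial f ∧ f ∈ J}, fun f hf => hf.1, le_antisymm ?_ ?_⟩
  · intro f hf
    exact hJ.le (Q := (Ideal.span {f | IsBinomial f ∧ f ∈ J}).restrictScalars k)
      (fun u v c h => Ideal.subset_span ⟨isBinomial_monomial_sub_monomial _ _ _ _, h⟩) hf
  · exact Ideal.span_le.2 fun f hf => hf.2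

/-- If `x ^ v` is not in the ideal `J`, then no nonzero multiple of it is. -/
theorem eq_zero_of_monomial_mem {J : Ideal (MvPolynomial ι k)} {v : ι →₀ ℕ} (hv : monomial v 1 ∉ J)
    {a : k} (ha : monomial v a ∈ J) : a = 0 := by
  by_contra h
  refine hv ?_
  have := J.mul_mem_left (C a⁻¹) ha
  rwa [C_mul_monomial, inv_mul_cancel₀ h] at this

/-- If `x^u ∉ J`, a monomial is congruent to at most one scalar multiple of `x^u`. Reading off this
scalar gives a linear form that kills every binomial of `J`, hence `J`. On `f` the term at `u`
contributes its nonzero coefficient, so another monomial of `f` must contribute too. -/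
theorem IsBinomialIdeal.binomialSpanned {J : Ideal (MvPolynomial ι k)} (hJ : IsBinomialIdeal J) :
    BinomialSpanned (J.restrictScalars k) := by
  classical
  intro f hf u hu
  by_cases hmu : monomial u (1 : k) ∈ J
  · exact Or.inl hmu
  right
  -- the linear form that reads off the coefficient of `x ^ u` in the class of `x ^ v`
  let g : (ι →₀ ℕ) → k := fun v =>
    if h : ∃ c : k, c ≠ 0 ∧ monomial v 1 - monomial u c ∈ J then h.choose else 0
  have hg : ∀ v (c : k), c ≠ 0 → monomial v 1 - monomial u c ∈ J → g v = c := by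
    intro v c hc hv
    have h : ∃ c : k, c ≠ 0 ∧ monomial v 1 - monomial u c ∈ J := ⟨c, hc, hv⟩
    have hgv : g v = h.choose := dif_pos h
    have := J.sub_mem hv h.choose_spec.2
    rw [sub_sub_sub_cancel_left, ← map_sub] at this
    rw [hgv]
    exact sub_eq_zero.1 (eq_zero_of_monomial_mem hmu this)
  have hg' : ∀ v, g v ≠ 0 → monomial v 1 - monomial u (g v) ∈ J := by
    intro v hv
    by_cases h : ∃ c : k, c ≠ 0 ∧ monomial v 1 - monomial u c ∈ J
    · have hgv : g v = h.choose := dif_pos h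
      rw [hgv]
      exact h.choose_spec.2
    · exact absurd (dif_neg h) hv
  -- Here `a x^v ≡ a g(v) x^u`, so `b x^w ≡ -a g(v) x^u` modulo `J`. The degenerate cases `a = 0`
  -- and `b = 0` use `x^u ∉ J`.
  have key : ∀ (v w : ι →₀ ℕ) (a b : k), monomial v a + monomial w b ∈ J →
      g v ≠ 0 → a * g v + b * g w = 0 := by
    intro v w a b hvw hv
    have h1 : monomial v a - monomial u (a * g v) ∈ J := by
      have := J.mul_mem_left (C a) (hg' v hv)
      rwa [mul_sub, C_mul_monomial, C_mul_monomial, mul_one] at this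
    have h2 : monomial w b + monomial u (a * g v) ∈ J := by
      have := J.sub_mem hvw h1
      convert this using 1
      ring
    by_cases ha : a = 0
    · subst ha
      simp only [zero_mul, map_zero, add_zero, zero_add] at h2 ⊢
      by_cases hw : g w = 0
      · simp [hw]
      · rw [mul_eq_zero]
        left
        by_contra hb
        have h3 : monomial w (1 : k) ∈ J := by
          have := J.mul_mem_left (C b⁻¹) h2
          rwa [C_mul_monomial, inv_mul_cancel₀ hb] at this
        have h4 := J.sub_mem h3 (hg' w hw)
        rw [sub_sub_cancel] at h4
        exact hw (eq_zero_of_monomial_mem hmu h4)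
    · by_cases hb : b = 0
      · subst hb
        simp only [map_zero, zero_add] at h2
        simp [eq_zero_of_monomial_mem hmu h2]
      · have h3 : monomial w 1 - monomial u (-(b⁻¹ * (a * g v))) ∈ J := by
          have := J.mul_mem_left (C b⁻¹) h2
          rw [mul_add, C_mul_monomial, C_mul_monomial, inv_mul_cancel₀ hb] at this
          rwa [map_neg, sub_neg_eq_add]
        have h4 := hg w _ (by simp [hb, ha, hv]) h3
        rw [h4]
        field_simp
        ring
  have key' : ∀ (v w : ι →₀ ℕ) (a b : k), monomial v a + monomial w b ∈ J →
      a * g v + b * g w = 0 := by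
    intro v w a b hvw
    by_cases hv : g v = 0
    · by_cases hw : g w = 0
      · simp [hv, hw]
      · rw [add_comm]
        exact key w v b a (by rwa [add_comm]) hw
    · exact key v w a b hvw hv
  have hgu : g u = 1 := hg u 1 one_ne_zero (by simp)
  obtain ⟨B, hB, rfl⟩ := hJ
  have hzero : pairing g f = 0 := by
    refine pairing_eq_zero_of_mem_span (fun b hb w => ?_) hf
    obtain ⟨u₁, u₂, a₁, a₂, rfl⟩ := (hB b hb).exists_eq
    have hm := Ideal.mul_mem_left (Ideal.span B) (monomial w 1) (Ideal.subset_span hb)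
    rw [mul_add, monomial_mul, monomial_mul, one_mul, one_mul] at hm ⊢
    rw [map_add, pairing_monomial, pairing_monomial]
    exact key' _ _ _ _ hm
  rw [pairing_eq_sum, ← Finset.add_sum_erase _ _ hu, hgu, mul_one] at hzero
  have hne : ∑ x ∈ f.support.erase u, coeff x f * g x ≠ 0 := by
    intro h
    rw [h, add_zero] at hzero
    exact mem_support_iff.1 hu hzero
  obtain ⟨v, hv, hv0⟩ := Finset.exists_ne_zero_of_sum_ne_zero hne
  have hgv : g v ≠ 0 := right_ne_zero_of_mul hv0
  refine ⟨v, (Finset.mem_erase.1 hv).2, (Finset.mem_erase.1 hv).1, (g v)⁻¹, ?_⟩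
  have := Ideal.mul_mem_left _ (C (-(g v)⁻¹)) (hg' v hgv)
  rw [mul_sub, C_mul_monomial, C_mul_monomial, mul_one, neg_mul, inv_mul_cancel₀ hgv, map_neg,
    map_neg] at this
  simpa [sub_eq_add_neg, add_comm] using! this

theorem IsBinomialIdeal.le {J Q : Ideal (MvPolynomial ι k)} (hJ : IsBinomialIdeal J)
    (h : ∀ u v c, monomial u 1 - monomial v c ∈ J → monomial u 1 - monomial v c ∈ Q) : J ≤ Q :=
  fun _ hf => hJ.binomialSpanned.le (Q := Q.restrictScalars k) h hf

theorem IsBinomialIdeal.sup_span_X {J : Ideal (MvPolynomial ι k)} (hJ : IsBinomialIdeal J)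
    (i : ι) : IsBinomialIdeal (J ⊔ Ideal.span {X i}) := by
  obtain ⟨B, hB, rfl⟩ := hJ
  refine ⟨B ∪ {X i}, ?_, by rw [Ideal.span_union]⟩
  rintro f (hf | rfl)
  · exact hB f hf
  · exact isBinomial_monomial _ _

theorem mem_saturation {J : Ideal (MvPolynomial ι k)} {f g : MvPolynomial ι k} :
    g ∈ saturation J f ↔ ∃ s : ℕ, g * f ^ s ∈ J := Iff.rfl

/-- Multiplication by `x_i^s` only shifts supports, so the criterion for `f * x_i^s ∈ J` pulls back
to `f`. -/
theorem IsBinomialIdeal.saturation_X {J : Ideal (MvPolynomial ι k)} (hJ : IsBinomialIdeal J)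
    (i : ι) : IsBinomialIdeal (saturation J (X i)) := by
  classical
  refine isBinomialIdeal_of_binomialSpanned fun f hf u hu => ?_
  obtain ⟨s, hs⟩ := hf
  have hX : (X i : MvPolynomial ι k) ^ s = monomial (Finsupp.single i s) 1 := X_pow_eq_monomial
  rw [hX] at hs
  have hmon : ∀ (w : ι →₀ ℕ) (c : k), monomial w c * monomial (Finsupp.single i s) 1 =
      monomial (w + Finsupp.single i s) c := fun w c => by rw [monomial_mul, mul_one]
  rcases hJ.binomialSpanned _ hs (u + Finsupp.single i s)
    (by rw [mem_support_iff, coeff_mul_monomial, mul_one]; exact mem_support_iff.1 hu) with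
    h | ⟨v, hv, hvu, c, hc⟩
  · left
    refine mem_saturation.2 ⟨s, ?_⟩
    rw [hX, hmon]
    exact h
  · right
    rw [mem_support_iff, coeff_mul_monomial'] at hv
    split_ifs at hv with hle
    · rw [mul_one] at hv
      refine ⟨v - Finsupp.single i s, mem_support_iff.2 hv, ?_, c, ?_⟩
      · rintro rfl
        exact hvu (tsub_add_cancel_of_le hle).symm
      · refine mem_saturation.2 ⟨s, ?_⟩
        rw [hX, sub_mul, hmon, hmon, tsub_add_cancel_of_le hle]
        exact hc
    · exact absurd rfl hv

theorem IsBinomialIdeal.restrictTo {J : Ideal (MvPolynomial ι k)} (hJ : IsBinomialIdeal J)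
    (𝓔 : Set ι) : IsBinomialIdeal (restrictTo 𝓔 J) := by
  classical
  refine isBinomialIdeal_of_binomialSpanned fun f hf u hu => ?_
  have hinj : Function.Injective ((↑) : 𝓔 → ι) := Subtype.val_injective
  have hmem : ∀ p, p ∈ BinomialMinPrimes.restrictTo 𝓔 J ↔ rename ((↑) : 𝓔 → ι) p ∈ J :=
    fun p => Iff.rfl
  rcases hJ.binomialSpanned _ hf (u.mapDomain (↑)) (by
    rw [mem_support_iff]
    exact (coeff_rename_mapDomain _ hinj f u).trans_ne (mem_support_iff.1 hu)) with
    h | ⟨v, hv, hvu, c, hc⟩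
  · left
    refine (hmem _).2 ?_
    rw [rename_monomial]
    exact h
  · right
    obtain ⟨w, rfl, hw⟩ := coeff_rename_ne_zero _ _ _ (mem_support_iff.1 hv)
    refine ⟨w, mem_support_iff.2 hw, fun h => hvu (by rw [h]), c, (hmem _).2 ?_⟩
    rw [map_sub, rename_monomial, rename_monomial]
    exact hc

end BinomialCriterion

/-! ### Lattice ideals and partial characters. -/

section LatticeIdeals

variable {ι k : Type*} [Field k]

/-- An exponent vector as an integer vector. -/
def toInt (u : ι →₀ ℕ) : ι → ℤ := fun i => (u i : ℤ)

@[simp]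
theorem toInt_add (u v : ι →₀ ℕ) : toInt (u + v) = toInt u + toInt v := by
  ext i
  simp [toInt]

@[simp]
theorem toInt_zero : toInt (0 : ι →₀ ℕ) = 0 := by
  ext i
  simp [toInt]

theorem toInt_injective : Function.Injective (toInt : (ι →₀ ℕ) → ι → ℤ) := by
  intro u v h
  ext i
  have := congrFun h i
  simpa [toInt] using this

namespace PartialCharacter

open Classical in
/-- The values of a partial character, extended by zero. -/
noncomputable def val (σ : PartialCharacter k ι) (m : ι → ℤ) : k :=
  if h : m ∈ σ.lattice then (σ.char (Multiplicative.ofAdd ⟨m, h⟩) : kˣ) else 0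

variable (σ : PartialCharacter k ι)

theorem val_of_mem {m : ι → ℤ} (h : m ∈ σ.lattice) :
    σ.val m = (σ.char (Multiplicative.ofAdd ⟨m, h⟩) : kˣ) := dif_pos h

theorem val_of_notMem {m : ι → ℤ} (h : m ∉ σ.lattice) : σ.val m = 0 := dif_neg h

theorem val_ne_zero_iff {m : ι → ℤ} : σ.val m ≠ 0 ↔ m ∈ σ.lattice := by
  refine ⟨fun h => ?_, fun h => ?_⟩
  · by_contra hm
    exact h (σ.val_of_notMem hm)
  · rw [σ.val_of_mem h]
    exact Units.ne_zero _

@[simp]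
theorem val_zero : σ.val 0 = 1 := by
  rw [σ.val_of_mem σ.lattice.zero_mem]
  have : (⟨0, σ.lattice.zero_mem⟩ : σ.lattice) = 0 := rfl
  rw [this, ofAdd_zero, map_one, Units.val_one]

theorem val_add {m : ι → ℤ} (hm : m ∈ σ.lattice) (l : ι → ℤ) :
    σ.val (m + l) = σ.val m * σ.val l := by
  by_cases hl : l ∈ σ.lattice
  · rw [σ.val_of_mem hm, σ.val_of_mem hl, σ.val_of_mem (σ.lattice.add_mem hm hl),
      ← Units.val_mul, ← map_mul]
    rfl
  · rw [σ.val_of_notMem hl, σ.val_of_notMem, mul_zero]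
    rwa [σ.lattice.add_mem_cancel_left hm]

theorem ext_val {σ σ' : PartialCharacter k ι} (h : ∀ m, σ.val m = σ'.val m) : σ = σ' := by
  have hL : σ.lattice = σ'.lattice := by
    ext m
    rw [← val_ne_zero_iff, h, val_ne_zero_iff]
  obtain ⟨L, c⟩ := σ
  obtain ⟨L', c'⟩ := σ'
  obtain rfl : L = L' := hL
  congr 1
  refine MonoidHom.ext fun m => Units.ext ?_
  have := h m.toAdd
  rwa [val_of_mem _ m.toAdd.2, val_of_mem _ m.toAdd.2] at this

/-- The linear forms that cut out the lattice ideal. -/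
noncomputable def form (u : ι →₀ ℕ) : MvPolynomial ι k →ₗ[k] k :=
  pairing fun w => σ.val (toInt w - toInt u)

theorem form_monomial (u w : ι →₀ ℕ) (a : k) :
    σ.form u (monomial w a) = a * σ.val (toInt w - toInt u) := pairing_monomial _ _ _

variable [Finite ι]

theorem monomial_sub_monomial_mem_latticeIdeal {u v : ι →₀ ℕ}
    (h : toInt u - toInt v ∈ σ.lattice) :
    monomial u 1 - monomial v (σ.val (toInt u - toInt v)) ∈ σ.latticeIdeal := by
  classical
  set m := toInt u - toInt v with hm
  have hgen : posMonomial k m - C (σ.val m) * posMonomial k (-m) ∈ σ.latticeIdeal :=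
    Ideal.subset_span ⟨⟨m, h⟩, by rw [σ.val_of_mem h]⟩
  -- The common factor `x^(u ⊓ v)` turns the generator for `m = u - v` into the required binomial.
  have := Ideal.mul_mem_left _ (monomial (u ⊓ v) 1) hgen
  have h1 : u ⊓ v + Finsupp.equivFunOnFinite.symm (fun i => (m i).toNat) = u := by
    ext i
    simp [hm, toInt]
    omega
  have h2 : u ⊓ v + Finsupp.equivFunOnFinite.symm (fun i => ((-m) i).toNat) = v := by
    ext i
    simp [hm, toInt]
    omega
  rwa [posMonomial, posMonomial, mul_sub, C_mul_monomial, monomial_mul, monomial_mul, h1, h2,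
    one_mul, one_mul, mul_one] at this

theorem toInt_posMonomial_exponent (m : ι → ℤ) :
    toInt (Finsupp.equivFunOnFinite.symm fun i => (m i).toNat) =
      m + toInt (Finsupp.equivFunOnFinite.symm fun i => ((-m) i).toNat) := by
  ext i
  simp [toInt]
  omega

theorem form_eq_zero_of_mem {f : MvPolynomial ι k} (hf : f ∈ σ.latticeIdeal) (u : ι →₀ ℕ) :
    σ.form u f = 0 := by
  refine pairing_eq_zero_of_mem_span ?_ hf
  rintro _ ⟨m, rfl⟩ w
  rw [posMonomial, posMonomial, C_mul_monomial, mul_sub, monomial_mul, monomial_mul, map_sub,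
    pairing_monomial, pairing_monomial, toInt_add, toInt_add, toInt_posMonomial_exponent]
  set n := Finsupp.equivFunOnFinite.symm fun i => ((-(m : ι → ℤ)) i).toNat
  have h : toInt w + ((m : ι → ℤ) + toInt n) - toInt u =
      (m : ι → ℤ) + (toInt w + toInt n - toInt u) := by abel
  rw [h, σ.val_add m.2, σ.val_of_mem m.2]
  ring

/-- The common kernel of the forms satisfies the binomial criterion, because `form u` gives weight
one to `x^u` and nonzero weight only to monomials congruent to a multiple of it. It then suffices to
compare binomials. -/
theorem mem_latticeIdeal_iff {f : MvPolynomial ι k} :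
    f ∈ σ.latticeIdeal ↔ ∀ u, σ.form u f = 0 := by
  refine ⟨fun hf u => σ.form_eq_zero_of_mem hf u, fun hf => ?_⟩
  let N : Submodule k (MvPolynomial ι k) := ⨅ u, LinearMap.ker (σ.form u)
  have hN : ∀ {g}, g ∈ N ↔ ∀ u, σ.form u g = 0 := by simp [N]
  have hIN : ∀ {g}, g ∈ σ.latticeIdeal → g ∈ N := fun hg =>
    hN.2 fun u => σ.form_eq_zero_of_mem hg u
  have hbs : BinomialSpanned N := by
    classical
    intro f hf u hu
    right
    have h0 := hN.1 hf u
    rw [form, pairing_eq_sum, ← Finset.add_sum_erase _ _ hu, sub_self, val_zero, mul_one] at h0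
    have hne : ∑ x ∈ f.support.erase u, coeff x f * σ.val (toInt x - toInt u) ≠ 0 := by
      intro h
      rw [h, add_zero] at h0
      exact mem_support_iff.1 hu h0
    obtain ⟨v, hv, hv0⟩ := Finset.exists_ne_zero_of_sum_ne_zero hne
    have hvL := σ.val_ne_zero_iff.1 (right_ne_zero_of_mul hv0)
    refine ⟨v, (Finset.mem_erase.1 hv).2, (Finset.mem_erase.1 hv).1, _,
      hIN (σ.monomial_sub_monomial_mem_latticeIdeal ?_)⟩
    rw [← neg_sub]
    exact σ.lattice.neg_mem hvL
  refine hbs.le (Q := σ.latticeIdeal.restrictScalars k) (fun u v c h => ?_) (hN.2 hf)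
  -- This reads `1 = c σ(v - u)`, which forces `v - u` into the lattice and determines `c`.
  have h1 := hN.1 h u
  rw [map_sub, form_monomial, form_monomial, sub_self, val_zero, one_mul] at h1
  have h2 : σ.val (toInt v - toInt u) ≠ 0 := by
    intro h
    rw [h] at h1
    simp at h1
  have hL : toInt u - toInt v ∈ σ.lattice := by
    rw [← neg_sub]
    exact σ.lattice.neg_mem (σ.val_ne_zero_iff.1 h2)
  have h3 : σ.val (toInt u - toInt v) * σ.val (toInt v - toInt u) = 1 := by
    rw [← σ.val_add hL, sub_add_sub_cancel, sub_self, val_zero]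
  have hc : c = σ.val (toInt u - toInt v) := by
    refine mul_right_cancel₀ h2 ?_
    rw [h3]
    linear_combination -h1
  rw [hc]
  exact σ.monomial_sub_monomial_mem_latticeIdeal hL

theorem latticeIdeal_le_iff {σ : PartialCharacter k ι} {J : Ideal (MvPolynomial ι k)} :
    σ.latticeIdeal ≤ J ↔ ∀ u v, toInt u - toInt v ∈ σ.lattice →
      monomial u 1 - monomial v (σ.val (toInt u - toInt v)) ∈ J := by
  refine ⟨fun h u v huv => h (σ.monomial_sub_monomial_mem_latticeIdeal huv), fun h => ?_⟩
  refine Ideal.span_le.2 ?_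
  rintro _ ⟨m, rfl⟩
  have hm := toInt_posMonomial_exponent (m : ι → ℤ)
  have hm' := sub_eq_of_eq_add hm
  have := h _ _ (hm' ▸ m.2)
  rw [hm', σ.val_of_mem m.2] at this
  rwa [posMonomial, posMonomial, C_mul_monomial, mul_one]

/-- Integer vectors as differences of exponent vectors. -/
theorem _root_.BinomialMinPrimes.exists_toInt_sub (m : ι → ℤ) :
    ∃ u v : ι →₀ ℕ, toInt u - toInt v = m :=
  ⟨_, _, sub_eq_of_eq_add (toInt_posMonomial_exponent m)⟩

/-- Applying `σ'.form v` to the binomial of `σ` for `u - v` recovers `σ(u - v)`. -/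
theorem latticeIdeal_injective :
    Function.Injective (latticeIdeal : PartialCharacter k ι → Ideal (MvPolynomial ι k)) := by
  have key : ∀ {σ σ' : PartialCharacter k ι}, σ.latticeIdeal = σ'.latticeIdeal →
      ∀ m ∈ σ.lattice, σ'.val m = σ.val m := by
    intro σ σ' h m hm
    obtain ⟨u, v, rfl⟩ := exists_toInt_sub m
    have h1 := σ.monomial_sub_monomial_mem_latticeIdeal hm
    rw [h] at h1
    have h2 := σ'.form_eq_zero_of_mem h1 v
    rw [map_sub, form_monomial, form_monomial, sub_self, val_zero] at h2
    linear_combination h2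
  intro σ σ' h
  refine ext_val fun m => ?_
  by_cases hm : m ∈ σ.lattice
  · exact (key h m hm).symm
  · by_cases hm' : m ∈ σ'.lattice
    · exact key h.symm m hm'
    · rw [val_of_notMem _ hm, val_of_notMem _ hm']

theorem isBinomialIdeal_latticeIdeal : IsBinomialIdeal σ.latticeIdeal := by
  refine ⟨_, ?_, rfl⟩
  rintro _ ⟨m, rfl⟩
  rw [posMonomial, posMonomial, C_mul_monomial]
  exact isBinomial_monomial_sub_monomial _ _ _ _

end PartialCharacter

theorem monomial_mul_mem_cancel {J : Ideal (MvPolynomial ι k)}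
    (hX : ∀ i f, X i * f ∈ J → f ∈ J) (u : ι →₀ ℕ) {f : MvPolynomial ι k}
    (h : monomial u 1 * f ∈ J) : f ∈ J := by
  classical
  induction u using Finsupp.induction_linear generalizing f with
  | zero => simpa using h
  | add u v hu hv =>
    refine hv (hu ?_)
    rwa [← mul_assoc, monomial_mul, mul_one]
  | single i n =>
    rw [← X_pow_eq_monomial] at h
    induction n with
    | zero => simpa using h
    | succ n ih =>
      refine ih (hX i _ ?_)
      rwa [← mul_assoc, ← pow_succ']

/-- Since monomials cancel modulo `J`, whether `x^u - c x^v ∈ J` depends only on `u - v` and `c`.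
Properness makes `c` unique and nonzero, so this relation is the graph of a partial character. -/
theorem exists_eq_latticeIdeal [Finite ι] {J : Ideal (MvPolynomial ι k)} (hJ : IsBinomialIdeal J)
    (hne : J ≠ ⊤) (hX : ∀ i f, X i * f ∈ J → f ∈ J) :
    ∃ σ : PartialCharacter k ι, J = σ.latticeIdeal := by
  have hmon : ∀ u : ι →₀ ℕ, monomial u (1 : k) ∉ J := by
    intro u hu
    refine hne ((Ideal.eq_top_iff_one _).2 (monomial_mul_mem_cancel hX u ?_))
    rwa [mul_one]
  have transfer : ∀ (u v u' v' : ι →₀ ℕ) (c : k), toInt u - toInt v = toInt u' - toInt v' →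
      monomial u 1 - monomial v c ∈ J → monomial u' 1 - monomial v' c ∈ J := by
    intro u v u' v' c h hJ
    have h' : v' + u = v + u' := by
      apply toInt_injective
      rw [toInt_add, toInt_add]
      linear_combination h
    refine monomial_mul_mem_cancel hX v ?_
    have := J.mul_mem_left (monomial v' 1) hJ
    rw [mul_sub, monomial_mul, monomial_mul, one_mul, one_mul] at this ⊢
    rwa [← h', add_comm v v']
  let R : (ι → ℤ) → kˣ → Prop := fun m c =>
    ∀ u v, toInt u - toInt v = m → monomial u 1 - monomial v (c : k) ∈ J
  have R_of : ∀ {u v : ι →₀ ℕ} {c : kˣ}, monomial u 1 - monomial v (c : k) ∈ J →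
      R (toInt u - toInt v) c := fun h u' v' h' => transfer _ _ _ _ _ h'.symm h
  have R_unique : ∀ {m c d}, R m c → R m d → c = d := by
    intro m c d hc hd
    obtain ⟨u, v, rfl⟩ := exists_toInt_sub m
    have := J.sub_mem (hd u v rfl) (hc u v rfl)
    rw [sub_sub_sub_cancel_left, ← map_sub] at this
    exact Units.ext (sub_eq_zero.1 (eq_zero_of_monomial_mem (hmon v) this))
  have R_add : ∀ {m m' c d}, R m c → R m' d → R (m + m') (c * d) := by
    intro m m' c d hc hd
    obtain ⟨u, v, rfl⟩ := exists_toInt_sub m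
    obtain ⟨u', v', rfl⟩ := exists_toInt_sub m'
    have h : toInt u - toInt v + (toInt u' - toInt v') = toInt (u + u') - toInt (v + v') := by
      rw [toInt_add, toInt_add]
      ring
    rw [h]
    refine R_of ?_
    have h1 := J.mul_mem_left (monomial u' 1) (hc u v rfl)
    have h2 := J.mul_mem_left (monomial v (c : k)) (hd u' v' rfl)
    have := J.add_mem h1 h2
    rw [mul_sub, mul_sub, monomial_mul, monomial_mul, monomial_mul, monomial_mul, add_comm u' v,
      one_mul, one_mul, mul_one, sub_add_sub_cancel, add_comm u' u] at this
    exact this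
  have R_zero : R 0 1 := by
    intro u v h
    rw [toInt_injective (sub_eq_zero.1 h)]
    simp
  have R_neg : ∀ {m c}, R m c → R (-m) c⁻¹ := by
    intro m c hc
    obtain ⟨u, v, rfl⟩ := exists_toInt_sub m
    rw [neg_sub]
    refine R_of ?_
    have := J.mul_mem_left (C (-((c⁻¹ : kˣ) : k))) (hc u v rfl)
    rw [mul_sub, C_mul_monomial, C_mul_monomial, mul_one, neg_mul, Units.inv_mul, map_neg,
      map_neg, neg_sub_neg] at this
    exact this
  let L : AddSubgroup (ι → ℤ) :=
    { carrier := {m | ∃ c, R m c}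
      zero_mem' := ⟨1, R_zero⟩
      add_mem' := fun ⟨c, hc⟩ ⟨d, hd⟩ => ⟨c * d, R_add hc hd⟩
      neg_mem' := fun ⟨c, hc⟩ => ⟨c⁻¹, R_neg hc⟩ }
  let χ : Multiplicative L →* kˣ :=
    { toFun := fun m => m.toAdd.2.choose
      map_one' := R_unique (Multiplicative.toAdd (1 : Multiplicative L)).2.choose_spec R_zero
      map_mul' := fun m m' => R_unique (Multiplicative.toAdd (m * m')).2.choose_spec
        (R_add m.toAdd.2.choose_spec m'.toAdd.2.choose_spec) }
  let σ : PartialCharacter k ι := ⟨L, χ⟩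
  have hσ : ∀ {m}, m ∈ L → ∃ c : kˣ, σ.val m = c ∧ R m c := fun {m} hm =>
    ⟨_, σ.val_of_mem hm, Exists.choose_spec (p := fun c => R m c) hm⟩
  refine ⟨σ, le_antisymm (hJ.le fun u v c h => ?_)
    (PartialCharacter.latticeIdeal_le_iff.2 fun u v huv => ?_)⟩
  · have hc : c ≠ 0 := by
      rintro rfl
      exact hmon u (by simpa using h)
    have hR : R (toInt u - toInt v) (Units.mk0 c hc) := R_of h
    obtain ⟨d, hd, hRd⟩ := hσ ⟨_, hR⟩
    have : c = σ.val (toInt u - toInt v) := by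
      rw [hd, ← R_unique hR hRd]
      rfl
    rw [this]
    exact σ.monomial_sub_monomial_mem_latticeIdeal ⟨_, hR⟩
  · obtain ⟨d, hd, hRd⟩ := hσ huv
    rw [hd]
    exact hRd u v rfl

end LatticeIdeals

/-! ### Extending and separating characters. -/

section CharacterExtension

variable {K : Type*} [Field K] [IsAlgClosed K]

/-- Roots exist in `K`, so `Kˣ` is divisible and therefore an injective abelian group by Baer's
criterion. -/
theorem exists_extension_of_char {G : Type*} [AddCommGroup G] (H : AddSubgroup G)
    (χ : Multiplicative H →* Kˣ) :
    ∃ ψ : Multiplicative G →* Kˣ, ∀ h : H,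
      ψ (Multiplicative.ofAdd (h : G)) = χ (Multiplicative.ofAdd h) := by
  have hdiv : ∀ {n : ℕ}, n ≠ 0 → Function.Surjective fun a : Additive Kˣ => n • a := by
    intro n hn a
    obtain ⟨z, hz⟩ := IsAlgClosed.exists_pow_nat_eq (a.toMul : K) (Nat.pos_of_ne_zero hn)
    have hz0 : z ≠ 0 := by
      rintro rfl
      rw [zero_pow hn] at hz
      exact (Units.ne_zero _) hz.symm
    exact ⟨Additive.ofMul (Units.mk0 z hz0), Additive.toMul.injective (Units.ext hz)⟩
  let : DivisibleBy (Additive Kˣ) ℕ := divisibleByOfSMulRightSurj _ _ hdiv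
  let : DivisibleBy (Additive Kˣ) ℤ := AddGroup.divisibleByIntOfDivisibleByNat _
  obtain ⟨ψ, hψ⟩ := (Module.Baer.of_divisible (Additive Kˣ)).extension_property_addMonoidHom
    H.subtype H.subtype_injective (MonoidHom.toAdditiveRight χ)
  exact ⟨MonoidHom.toAdditiveRight.symm ψ, fun h => DFunLike.congr_fun hψ h⟩

/-- The class of `m` generates a finite cyclic subgroup of `G ⧸ L`. In characteristic zero `K` has
enough roots of unity for a character nontrivial on it, which is then extended to `G ⧸ L`. -/
theorem exists_char_ne_one [CharZero K] {G : Type*} [AddCommGroup G] (L : AddSubgroup G) {m : G}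
    (hm : m ∉ L) {d : ℤ} (hd : d ≠ 0) (hdm : d • m ∈ L) :
    ∃ ψ : Multiplicative G →* Kˣ, (∀ l ∈ L, ψ (Multiplicative.ofAdd l) = 1) ∧
      ψ (Multiplicative.ofAdd m) ≠ 1 := by
  let a : G ⧸ L := QuotientAddGroup.mk m
  have ha0 : a ≠ 0 := fun h => hm ((QuotientAddGroup.eq_zero_iff m).1 h)
  have hfin : IsOfFinAddOrder a := isOfFinAddOrder_iff_zsmul_eq_zero.2
    ⟨d, hd, (QuotientAddGroup.eq_zero_iff (d • m)).2 hdm⟩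
  have : Finite (AddSubgroup.zmultiples a) := hfin.finite_zmultiples
  have : Finite (Multiplicative (AddSubgroup.zmultiples a)) := ‹_›
  have : NeZero ((Monoid.exponent (Multiplicative (AddSubgroup.zmultiples a)) : ℕ) : K) :=
    ⟨Nat.cast_ne_zero.2 Monoid.exponent_ne_zero_of_finite⟩
  let b : AddSubgroup.zmultiples a := ⟨a, AddSubgroup.mem_zmultiples a⟩
  obtain ⟨φ, hφ⟩ := CommGroup.exists_apply_ne_one_of_hasEnoughRootsOfUnity
    (Multiplicative (AddSubgroup.zmultiples a)) K (a := Multiplicative.ofAdd b)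
    (fun h => ha0 (congrArg (fun x => ((Multiplicative.toAdd x : AddSubgroup.zmultiples a) : G ⧸ L))
      h))
  obtain ⟨ψ, hψ⟩ := exists_extension_of_char (AddSubgroup.zmultiples a) φ
  refine ⟨ψ.comp (AddMonoidHom.toMultiplicative (QuotientAddGroup.mk' L)), fun l hl => ?_, ?_⟩
  · have : (QuotientAddGroup.mk' L) l = 0 := (QuotientAddGroup.eq_zero_iff l).2 hl
    change ψ (Multiplicative.ofAdd ((QuotientAddGroup.mk' L) l)) = 1
    rw [this, ofAdd_zero, map_one]
  · have := hψ b
    change ψ (Multiplicative.ofAdd a) ≠ 1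
    rwa [this]

end CharacterExtension

/-! ### Saturations of a partial character. -/

section Saturations

variable {ι k : Type*} [Field k]

theorem satLattice_satLattice_le (L : AddSubgroup (ι → ℤ)) :
    satLattice (satLattice L) ≤ satLattice L := by
  rintro m ⟨d, hd, e, he, h⟩
  exact ⟨e * d, mul_ne_zero he hd, by rwa [mul_smul]⟩

namespace PartialCharacter

theorem IsSaturationOf.val_eq {τ σ : PartialCharacter k ι} (h : τ.IsSaturationOf σ) {m : ι → ℤ}
    (hm : m ∈ σ.lattice) : τ.val m = σ.val m := by
  have hτ : m ∈ τ.lattice := by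
    rw [h.1]
    exact ⟨1, one_ne_zero, by simpa using hm⟩
  rw [τ.val_of_mem hτ, σ.val_of_mem hm, h.2 m hm hτ]

theorem val_nsmul (σ : PartialCharacter k ι) {m : ι → ℤ} (hm : m ∈ σ.lattice) (n : ℕ) :
    σ.val (n • m) = σ.val m ^ n := by
  induction n with
  | zero => simp
  | succ n ih => rw [succ_nsmul', σ.val_add hm, ih, pow_succ']

theorem val_neg (σ : PartialCharacter k ι) {m : ι → ℤ} (hm : m ∈ σ.lattice) :
    σ.val (-m) = (σ.val m)⁻¹ := by
  refine eq_inv_of_mul_eq_one_right ?_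
  rw [← σ.val_add hm, add_neg_cancel, val_zero]

/-- A saturation is determined on finitely many generators of `Sat(𝓛)`, and its value at each is a
root of a prescribed element. -/
theorem finite_setOf_isSaturationOf [Finite ι] (σ : PartialCharacter k ι) :
    {τ : PartialCharacter k ι | τ.IsSaturationOf σ}.Finite := by
  classical
  obtain ⟨s, hs⟩ : (satLattice σ.lattice).FG := by
    have := IsNoetherian.noetherian (AddSubgroup.toIntSubmodule (satLattice σ.lattice))
    rwa [Submodule.fg_iff_addSubgroup_fg] at this
  have hroots : ∀ g : s, ∃ t : Set k, t.Finite ∧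
      ∀ τ : PartialCharacter k ι, τ.IsSaturationOf σ → τ.val g ∈ t := by
    intro g
    have hg : (g : ι → ℤ) ∈ satLattice σ.lattice := by
      rw [← hs]
      exact AddSubgroup.subset_closure g.2
    obtain ⟨d, hd, hdg⟩ := hg
    have hdg' : d.natAbs • (g : ι → ℤ) ∈ σ.lattice := by
      rw [← natCast_zsmul, Int.natCast_natAbs]
      rcases abs_choice d with h | h
      · rwa [h]
      · rw [h, neg_smul]
        exact σ.lattice.neg_mem hdg
    have hd' : 0 < d.natAbs := Int.natAbs_pos.2 hd
    refine ⟨(Polynomial.nthRoots d.natAbs (σ.val (d.natAbs • (g : ι → ℤ)))).toFinset,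
      Finset.finite_toSet _, fun τ hτ => ?_⟩
    rw [Finset.mem_coe, Multiset.mem_toFinset, Polynomial.mem_nthRoots hd', ← τ.val_nsmul,
      hτ.val_eq hdg']
    rw [hτ.1]
    exact ⟨d, hd, hdg⟩
  choose t ht hτt using hroots
  refine Set.Finite.of_injOn (f := fun τ (g : s) => τ.val (g : ι → ℤ))
    (t := Set.univ.pi t) (fun τ hτ g _ => hτt g τ hτ) (fun τ hτ τ' hτ' h => ?_)
    (Set.Finite.pi' ht |>.subset fun f hf g => hf g trivial)
  refine ext_val fun m => ?_
  by_cases hm : m ∈ satLattice σ.lattice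
  · rw [← hs] at hm
    have hmem : ∀ {x}, x ∈ AddSubgroup.closure (s : Set (ι → ℤ)) →
        x ∈ τ.lattice ∧ x ∈ τ'.lattice := fun hx => by
      rw [hτ.1, hτ'.1]
      exact ⟨hs ▸ hx, hs ▸ hx⟩
    induction hm using AddSubgroup.closure_induction with
    | mem x hx => exact congrFun h ⟨x, hx⟩
    | zero => simp
    | add x y hx hy ihx ihy => rw [val_add _ (hmem hx).1, val_add _ (hmem hx).2, ihx, ihy]
    | neg x hx ihx => rw [val_neg _ (hmem hx).1, val_neg _ (hmem hx).2, ihx]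
  · rw [val_of_notMem, val_of_notMem]
    · rwa [hτ'.1]
    · rwa [hτ.1]

/-- The restriction of a character of `ℤ^ι` to a lattice. -/
def ofChar (L : AddSubgroup (ι → ℤ)) (ψ : Multiplicative (ι → ℤ) →* kˣ) :
    PartialCharacter k ι where
  lattice := L
  char := ψ.comp (AddMonoidHom.toMultiplicative L.subtype)

/-- The product of a partial character with a character of `ℤ^ι`. -/
def twist (τ : PartialCharacter k ι) (ψ : Multiplicative (ι → ℤ) →* kˣ) :
    PartialCharacter k ι where
  lattice := τ.lattice
  char := τ.char * ψ.comp (AddMonoidHom.toMultiplicative τ.lattice.subtype)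

theorem val_twist (τ : PartialCharacter k ι) (ψ : Multiplicative (ι → ℤ) →* kˣ) (m : ι → ℤ) :
    (τ.twist ψ).val m = τ.val m * ψ (Multiplicative.ofAdd m) := by
  by_cases hm : m ∈ τ.lattice
  · rw [τ.val_of_mem hm, val_of_mem _ (show m ∈ (τ.twist ψ).lattice from hm), ← Units.val_mul]
    rfl
  · rw [τ.val_of_notMem hm, val_of_notMem _ (show m ∉ (τ.twist ψ).lattice from hm), zero_mul]

theorem twist_twist_inv (τ : PartialCharacter k ι) (ψ : Multiplicative (ι → ℤ) →* kˣ) :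
    (τ.twist ψ).twist ψ⁻¹ = τ := by
  refine ext_val fun m => ?_
  rw [val_twist, val_twist, MonoidHom.inv_apply, Units.mul_inv_cancel_right]

theorem IsSaturationOf.twist {τ σ : PartialCharacter k ι} (h : τ.IsSaturationOf σ)
    {ψ : Multiplicative (ι → ℤ) →* kˣ} (hψ : ∀ l ∈ σ.lattice, ψ (Multiplicative.ofAdd l) = 1) :
    (τ.twist ψ).IsSaturationOf σ := by
  refine ⟨h.1, fun m hσ hτ => ?_⟩
  rw [← h.2 m hσ hτ]
  change τ.char (Multiplicative.ofAdd ⟨m, hτ⟩) * ψ (Multiplicative.ofAdd m) = _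
  rw [hψ m hσ]
  exact mul_one _

variable [IsAlgClosed k]

theorem exists_isSaturationOf (σ : PartialCharacter k ι) :
    ∃ τ : PartialCharacter k ι, τ.IsSaturationOf σ := by
  obtain ⟨ψ, hψ⟩ := exists_extension_of_char σ.lattice σ.char
  exact ⟨ofChar (satLattice σ.lattice) ψ, rfl, fun m hσ _ => hψ ⟨m, hσ⟩⟩

variable [CharZero k] [Finite ι]

/-- Orthogonality: for `m` in `Sat(𝓛)` but not in `𝓛`, twisting by a character trivial on `𝓛` but
not at `m` permutes the saturations and multiplies the sum by a factor other than one. -/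
theorem sum_val_isSaturationOf (σ : PartialCharacter k ι) (m : ι → ℤ) :
    ∑ τ ∈ σ.finite_setOf_isSaturationOf.toFinset, τ.val m =
      σ.finite_setOf_isSaturationOf.toFinset.card * σ.val m := by
  by_cases hm : m ∈ σ.lattice
  · rw [Finset.sum_congr rfl fun τ hτ =>
      IsSaturationOf.val_eq (σ.finite_setOf_isSaturationOf.mem_toFinset.1 hτ) hm,
      Finset.sum_const, nsmul_eq_mul]
  rw [σ.val_of_notMem hm, mul_zero]
  by_cases hm' : m ∈ satLattice σ.lattice
  · obtain ⟨d, hd, hdm⟩ := hm'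
    obtain ⟨ψ, hψ, hψm⟩ := exists_char_ne_one (K := k) σ.lattice hm hd hdm
    have hψ' : ∀ l ∈ σ.lattice, ψ⁻¹ (Multiplicative.ofAdd l) = 1 := fun l hl => by
      rw [MonoidHom.inv_apply, hψ l hl, inv_one]
    have h : ∑ τ ∈ σ.finite_setOf_isSaturationOf.toFinset, τ.val m =
        ∑ τ ∈ σ.finite_setOf_isSaturationOf.toFinset, (τ.twist ψ).val m := by
      symm
      refine Finset.sum_nbij' (fun τ => τ.twist ψ) (fun τ => τ.twist ψ⁻¹) ?_ ?_ ?_ ?_ ?_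
      · intro τ hτ
        simp only [Set.Finite.mem_toFinset, Set.mem_ofPred_eq] at hτ ⊢
        exact hτ.twist hψ
      · intro τ hτ
        simp only [Set.Finite.mem_toFinset, Set.mem_ofPred_eq] at hτ ⊢
        exact hτ.twist hψ'
      · exact fun τ _ => τ.twist_twist_inv ψ
      · intro τ _
        have := τ.twist_twist_inv ψ⁻¹
        have h : ψ⁻¹⁻¹ = ψ := MonoidHom.ext fun x => inv_inv (ψ x)
        rwa [h] at this
      · exact fun _ _ => rfl
    simp only [val_twist, ← Finset.sum_mul] at h
    have hne : (1 - (ψ (Multiplicative.ofAdd m) : k)) ≠ 0 := by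
      rw [sub_ne_zero]
      exact fun h => hψm (Units.ext h.symm)
    refine (mul_eq_zero.1 ?_).resolve_right hne
    rw [mul_sub, mul_one, ← h, sub_self]
  · refine Finset.sum_eq_zero fun τ hτ => τ.val_of_notMem ?_
    rw [(σ.finite_setOf_isSaturationOf.mem_toFinset.1 hτ).1]
    exact hm'

/-- The forms of `σ` are averages of those of its saturations; the number of saturations is
invertible in characteristic zero. -/
theorem mem_latticeIdeal_of_forall_isSaturationOf (σ : PartialCharacter k ι)
    {f : MvPolynomial ι k}
    (hf : ∀ τ : PartialCharacter k ι, τ.IsSaturationOf σ → f ∈ τ.latticeIdeal) :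
    f ∈ σ.latticeIdeal := by
  rw [mem_latticeIdeal_iff]
  intro u
  have h : ∑ τ ∈ σ.finite_setOf_isSaturationOf.toFinset, τ.form u f =
      σ.finite_setOf_isSaturationOf.toFinset.card * σ.form u f := by
    simp only [form, pairing_eq_sum]
    rw [Finset.sum_comm, Finset.mul_sum]
    refine Finset.sum_congr rfl fun w _ => ?_
    rw [← Finset.mul_sum, sum_val_isSaturationOf]
    ring
  rw [Finset.sum_eq_zero fun τ hτ => (τ.mem_latticeIdeal_iff.1
    (hf τ (σ.finite_setOf_isSaturationOf.mem_toFinset.1 hτ)) u)] at h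
  refine (mul_eq_zero.1 h.symm).resolve_left (Nat.cast_ne_zero.2 (Finset.card_ne_zero.2 ?_))
  obtain ⟨τ, hτ⟩ := σ.exists_isSaturationOf
  exact ⟨τ, σ.finite_setOf_isSaturationOf.mem_toFinset.2 hτ⟩

end PartialCharacter

theorem latticeIdeal_le_latticeIdeal [Finite ι] {τ σ : PartialCharacter k ι}
    (h : τ.IsSaturationOf σ) : σ.latticeIdeal ≤ τ.latticeIdeal := by
  refine PartialCharacter.latticeIdeal_le_iff.2 fun u v huv => ?_
  rw [← h.val_eq huv]
  refine τ.monomial_sub_monomial_mem_latticeIdeal ?_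
  rw [h.1]
  exact ⟨1, one_ne_zero, by simpa using huv⟩

end Saturations

/-! ### Primality for saturated lattices. -/

section Primality

variable {ι k : Type*} [Field k]

/-- The homomorphism `x ^ u ↦ ψ(u) [u]` to the group algebra of `ℤ^ι ⧸ L`. -/
noncomputable def toGroupAlgebra (L : AddSubgroup (ι → ℤ)) (ψ : Multiplicative (ι → ℤ) →* kˣ) :
    MvPolynomial ι k →ₐ[k] AddMonoidAlgebra k ((ι → ℤ) ⧸ L) :=
  aeval fun i => AddMonoidAlgebra.single (QuotientAddGroup.mk (toInt (Finsupp.single i 1)))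
    (ψ (Multiplicative.ofAdd (toInt (Finsupp.single i 1))) : k)

theorem toGroupAlgebra_monomial (L : AddSubgroup (ι → ℤ)) (ψ : Multiplicative (ι → ℤ) →* kˣ)
    (u : ι →₀ ℕ) (a : k) :
    toGroupAlgebra L ψ (monomial u a) = AddMonoidAlgebra.single (QuotientAddGroup.mk (toInt u))
      (a * (ψ (Multiplicative.ofAdd (toInt u)) : k)) := by
  have h1 : toGroupAlgebra L ψ (monomial u 1) = AddMonoidAlgebra.single
      (QuotientAddGroup.mk (toInt u)) (ψ (Multiplicative.ofAdd (toInt u)) : k) := by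
    induction u using Finsupp.induction_linear with
    | zero =>
      rw [toInt_zero, ofAdd_zero, map_one ψ, Units.val_one, monomial_zero', C_1,
        map_one (toGroupAlgebra L ψ)]
      rfl
    | add u v hu hv =>
      rw [← one_mul (1 : k), ← monomial_mul, map_mul, hu, hv, AddMonoidAlgebra.single_mul_single,
        toInt_add, ofAdd_add, map_mul, Units.val_mul]
      rfl
    | single i n =>
      rw [← X_pow_eq_monomial, map_pow, toGroupAlgebra, aeval_X, AddMonoidAlgebra.single_pow]
      have h : toInt (Finsupp.single i n) = n • toInt (Finsupp.single i 1) := by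
        ext j
        by_cases hij : i = j
        · subst hij
          simp [toInt]
        · simp [toInt, hij]
      rw [h, ofAdd_nsmul, map_pow, Units.val_pow_eq_pow_val]
      rfl
  have h2 : monomial u a = a • monomial u 1 := by rw [smul_monomial, smul_eq_mul, mul_one]
  rw [h2, map_smul, h1, AddMonoidAlgebra.smul_single, smul_eq_mul]

variable [Finite ι]

/-- The coefficient of the image of `f` at `[u]` is `ψ(u)` times `τ.form u f`. -/
theorem ker_toGroupAlgebra (τ : PartialCharacter k ι) {ψ : Multiplicative (ι → ℤ) →* kˣ}
    (hψ : ∀ m ∈ τ.lattice, τ.val m = ψ (Multiplicative.ofAdd m)) :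
    RingHom.ker (toGroupAlgebra τ.lattice ψ) = τ.latticeIdeal := by
  classical
  refine le_antisymm (fun f hf => ?_) ?_
  · rw [RingHom.mem_ker] at hf
    rw [τ.mem_latticeIdeal_iff]
    intro u
    have hsum : toGroupAlgebra τ.lattice ψ f = ∑ w ∈ f.support, AddMonoidAlgebra.single
        (QuotientAddGroup.mk (toInt w)) (f.coeff w * (ψ (Multiplicative.ofAdd (toInt w)) : k)) := by
      conv_lhs => rw [f.as_sum, map_sum]
      exact Finset.sum_congr rfl fun w _ => toGroupAlgebra_monomial _ _ _ _
    have h0 : (toGroupAlgebra τ.lattice ψ f).coeff (QuotientAddGroup.mk (toInt u)) = 0 := by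
      rw [hf]
      rfl
    have h1 : (toGroupAlgebra τ.lattice ψ f).coeff (QuotientAddGroup.mk (toInt u)) =
        (ψ (Multiplicative.ofAdd (toInt u)) : k) * τ.form u f := by
      rw [hsum, AddMonoidAlgebra.coeff_sum, Finsupp.finsetSum_apply, PartialCharacter.form,
        pairing_eq_sum, Finset.mul_sum]
      refine Finset.sum_congr rfl fun w _ => ?_
      rw [AddMonoidAlgebra.coeff_single, Finsupp.single_apply]
      by_cases hw : toInt w - toInt u ∈ τ.lattice
      · rw [if_pos, hψ _ hw]
        · have : (ψ (Multiplicative.ofAdd (toInt w)) : k) =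
              ψ (Multiplicative.ofAdd (toInt u)) * ψ (Multiplicative.ofAdd (toInt w - toInt u)) := by
            rw [← Units.val_mul, ← map_mul, ← ofAdd_add, add_sub_cancel]
          rw [this]
          ring
        · rw [eq_comm, QuotientAddGroup.eq]
          rwa [neg_add_eq_sub]
      · rw [if_neg, τ.val_of_notMem hw, mul_zero, mul_zero]
        rw [eq_comm, QuotientAddGroup.eq]
        rwa [neg_add_eq_sub]
    rw [h1] at h0
    exact (mul_eq_zero.1 h0).resolve_left (Units.ne_zero _)
  · refine PartialCharacter.latticeIdeal_le_iff.2 fun u v huv => ?_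
    rw [RingHom.mem_ker, map_sub, toGroupAlgebra_monomial, toGroupAlgebra_monomial, one_mul,
      hψ _ huv, ← Units.val_mul, ← map_mul, ← ofAdd_add, sub_add_cancel, sub_eq_zero]
    congr 1
    rw [eq_comm, QuotientAddGroup.eq]
    rwa [neg_add_eq_sub]

/-- For a saturated lattice the quotient group is torsion-free, so its group algebra is a domain.
Algebraic closedness serves to extend `τ` to all of `ℤ^ι`. -/
theorem PartialCharacter.isPrime_latticeIdeal [IsAlgClosed k] (τ : PartialCharacter k ι)
    (hτ : satLattice τ.lattice ≤ τ.lattice) : τ.latticeIdeal.IsPrime := by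
  obtain ⟨ψ, hψ⟩ := exists_extension_of_char τ.lattice τ.char
  have : IsAddTorsionFree ((ι → ℤ) ⧸ τ.lattice) := by
    refine ⟨fun n hn x y hxy => ?_⟩
    induction x using QuotientAddGroup.induction_on with | H x
    induction y using QuotientAddGroup.induction_on with | H y
    rw [QuotientAddGroup.eq]
    refine hτ ⟨n, Nat.cast_ne_zero.2 hn, ?_⟩
    have h := (QuotientAddGroup.eq (s := τ.lattice) (a := n • x) (b := n • y)).1 hxy
    rwa [natCast_zsmul, smul_add, smul_neg]
  rw [← ker_toGroupAlgebra τ (ψ := ψ) fun m hm => by rw [τ.val_of_mem hm, ← hψ]]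
  exact RingHom.ker_isPrime _

theorem PartialCharacter.IsSaturationOf.isPrime_latticeIdeal [IsAlgClosed k]
    {τ σ : PartialCharacter k ι} (h : τ.IsSaturationOf σ) : τ.latticeIdeal.IsPrime := by
  refine τ.isPrime_latticeIdeal ?_
  rw [h.1]
  exact satLattice_satLattice_le _

end Primality

/-! ### The ideals `M(𝓔) + I₊(σ)`. -/

section CellIdeals

variable {ι k : Type*} [Field k]

theorem sub_rename_killCompl_mem (𝓔 : Set ι) (f : MvPolynomial ι k) :
    f - rename ((↑) : 𝓔 → ι) (killCompl Subtype.val_injective f) ∈ nonCellIdeal k 𝓔 := by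
  induction f using MvPolynomial.induction_on with
  | C a => simp
  | add p q hp hq =>
    rw [map_add, map_add, add_sub_add_comm]
    exact add_mem hp hq
  | mul_X p i hp =>
    by_cases hi : i ∈ 𝓔
    · have hX : (X i : MvPolynomial ι k) = rename ((↑) : 𝓔 → ι) (X ⟨i, hi⟩) := by simp
      rw [map_mul, map_mul]
      conv in killCompl _ (X i) => rw [hX]
      rw [killCompl_rename_app, ← hX, ← sub_mul]
      exact Ideal.mul_mem_right _ _ hp
    · have hX : killCompl (R := k) (Subtype.val_injective : Function.Injective ((↑) : 𝓔 → ι))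
          (X i) = 0 := by
        rw [killCompl, aeval_X, dif_neg]
        simpa using hi
      rw [map_mul, hX, mul_zero, map_zero, sub_zero]
      exact Ideal.mul_mem_left _ _ (Ideal.subset_span ⟨i, hi, rfl⟩)

/-- Setting the variables outside `𝓔` to zero is a retraction onto `k[𝓔]`, and it changes a
polynomial only by an element of `M(𝓔)`. This reduces questions on cell ideals to lattice ideals. -/
theorem nonCellIdeal_sup_extendFrom (𝓔 : Set ι) (J : Ideal (MvPolynomial 𝓔 k)) :
    nonCellIdeal k 𝓔 ⊔ extendFrom 𝓔 J =
      J.comap (killCompl (Subtype.val_injective : Function.Injective ((↑) : 𝓔 → ι))) := by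
  refine le_antisymm (sup_le (Ideal.span_le.2 ?_) (Ideal.map_le_iff_le_comap.2 fun f hf => ?_))
    fun f hf => ?_
  · rintro _ ⟨i, hi, rfl⟩
    rw [SetLike.mem_coe, Ideal.mem_comap, killCompl, aeval_X, dif_neg]
    · exact J.zero_mem
    · simpa using hi
  · rw [Ideal.mem_comap, Ideal.mem_comap, killCompl_rename_app]
    exact hf
  · rw [← sub_add_cancel f (rename ((↑) : 𝓔 → ι) (killCompl Subtype.val_injective f))]
    exact add_mem (Ideal.mem_sup_left (sub_rename_killCompl_mem 𝓔 f))
      (Ideal.mem_sup_right (Ideal.mem_map_of_mem _ hf))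

theorem mem_cellIdeal [Finite ι] {𝓔 : Set ι} {σ : PartialCharacter k 𝓔} {f : MvPolynomial ι k} :
    f ∈ cellIdeal 𝓔 σ ↔ killCompl Subtype.val_injective f ∈ σ.latticeIdeal := by
  rw [cellIdeal, nonCellIdeal_sup_extendFrom]
  rfl

theorem isBinomialIdeal_cellIdeal [Finite ι] (𝓔 : Set ι) (σ : PartialCharacter k 𝓔) :
    IsBinomialIdeal (cellIdeal 𝓔 σ) := by
  obtain ⟨B, hB, hσ⟩ := σ.isBinomialIdeal_latticeIdeal
  refine ⟨{f | ∃ i, i ∉ 𝓔 ∧ f = X i} ∪ rename ((↑) : 𝓔 → ι) '' B, ?_, ?_⟩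
  · rintro _ (⟨i, -, rfl⟩ | ⟨f, hf, rfl⟩)
    · exact isBinomial_monomial _ _
    · unfold IsBinomial
      classical
      rw [support_rename_of_injective Subtype.val_injective]
      exact Finset.card_image_le.trans (hB f hf)
  · rw [cellIdeal, extendFrom, hσ, Ideal.map_span, Ideal.span_union]
    rfl

theorem isPrime_cellIdeal [Finite ι] [IsAlgClosed k] {𝓔 : Set ι} {τ σ : PartialCharacter k 𝓔}
    (h : τ.IsSaturationOf σ) : (cellIdeal 𝓔 τ).IsPrime := by
  have := h.isPrime_latticeIdeal
  rw [cellIdeal, nonCellIdeal_sup_extendFrom]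
  exact Ideal.comap_isPrime _ _

theorem cellIdeal_le_cellIdeal [Finite ι] {𝓔 : Set ι} {τ σ : PartialCharacter k 𝓔}
    (h : τ.IsSaturationOf σ) : cellIdeal 𝓔 σ ≤ cellIdeal 𝓔 τ :=
  fun _ hf => mem_cellIdeal.2 (latticeIdeal_le_latticeIdeal h (mem_cellIdeal.1 hf))

theorem mem_cellIdeal_of_forall_isSaturationOf [Finite ι] [IsAlgClosed k] [CharZero k] {𝓔 : Set ι}
    {σ : PartialCharacter k 𝓔} {f : MvPolynomial ι k}
    (h : ∀ τ : PartialCharacter k 𝓔, τ.IsSaturationOf σ → f ∈ cellIdeal 𝓔 τ) :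
    f ∈ cellIdeal 𝓔 σ :=
  mem_cellIdeal.2 (σ.mem_latticeIdeal_of_forall_isSaturationOf fun τ hτ => mem_cellIdeal.1 (h τ hτ))

theorem isRadical_cellIdeal_of_isAlgClosed [Finite ι] [IsAlgClosed k] [CharZero k] (𝓔 : Set ι)
    (σ : PartialCharacter k 𝓔) : (cellIdeal 𝓔 σ).IsRadical := by
  rintro f ⟨n, hf⟩
  exact mem_cellIdeal_of_forall_isSaturationOf fun τ hτ =>
    (isPrime_cellIdeal hτ).mem_of_pow_mem n (cellIdeal_le_cellIdeal hτ hf)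

theorem exists_cellIdeal_le_of_isPrime [Finite ι] [IsAlgClosed k] [CharZero k] {𝓔 : Set ι}
    {σ : PartialCharacter k 𝓔} {P : Ideal (MvPolynomial ι k)} (hP : P.IsPrime)
    (h : cellIdeal 𝓔 σ ≤ P) :
    ∃ τ : PartialCharacter k 𝓔, τ.IsSaturationOf σ ∧ cellIdeal 𝓔 τ ≤ P := by
  have hinf : σ.finite_setOf_isSaturationOf.toFinset.inf (cellIdeal 𝓔) ≤ P := by
    refine le_trans (fun f hf => mem_cellIdeal_of_forall_isSaturationOf fun τ hτ => ?_) h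
    exact Finset.inf_le (f := cellIdeal 𝓔) (σ.finite_setOf_isSaturationOf.mem_toFinset.2 hτ) hf
  obtain ⟨τ, hτ, hle⟩ := hP.inf_le'.1 hinf
  exact ⟨τ, σ.finite_setOf_isSaturationOf.mem_toFinset.1 hτ, hle⟩

end CellIdeals

/-! ### Extension of scalars from `k` to `K`. -/

section BaseChange

variable {ι k : Type*} [Field k] (K : Type*) [Field K] [Algebra k K]

theorem PartialCharacter.val_baseChange (σ : PartialCharacter k ι) (m : ι → ℤ) :
    (σ.baseChange K).val m = algebraMap k K (σ.val m) := by
  by_cases hm : m ∈ σ.lattice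
  · rw [σ.val_of_mem hm, val_of_mem _ (show m ∈ (σ.baseChange K).lattice from hm)]
    rfl
  · rw [σ.val_of_notMem hm, val_of_notMem _ (show m ∉ (σ.baseChange K).lattice from hm), map_zero]

theorem map_mem_latticeIdeal_baseChange [Finite ι] {σ : PartialCharacter k ι}
    {f : MvPolynomial ι k} :
    MvPolynomial.map (algebraMap k K) f ∈ (σ.baseChange K).latticeIdeal ↔ f ∈ σ.latticeIdeal := by
  have h : ∀ u, (σ.baseChange K).form u (MvPolynomial.map (algebraMap k K) f) =
      algebraMap k K (σ.form u f) := by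
    intro u
    rw [PartialCharacter.form, PartialCharacter.form, pairing_eq_sum, pairing_eq_sum,
      support_map_of_injective _ (algebraMap k K).injective, map_sum]
    exact Finset.sum_congr rfl fun w _ => by
      rw [coeff_map, PartialCharacter.val_baseChange, map_mul]
  rw [PartialCharacter.mem_latticeIdeal_iff, PartialCharacter.mem_latticeIdeal_iff]
  simp [h]

theorem map_mem_cellIdeal_baseChange [Finite ι] {𝓔 : Set ι} {σ : PartialCharacter k 𝓔}
    {f : MvPolynomial ι k} :
    MvPolynomial.map (algebraMap k K) f ∈ cellIdeal 𝓔 (σ.baseChange K) ↔ f ∈ cellIdeal 𝓔 σ := by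
  rw [mem_cellIdeal, mem_cellIdeal, killCompl_map, map_mem_latticeIdeal_baseChange]

theorem map_posMonomial [Finite ι] (m : ι → ℤ) :
    MvPolynomial.map (algebraMap k K) (posMonomial k m) = posMonomial K m := by
  rw [posMonomial, posMonomial, map_monomial, map_one]

theorem map_latticeIdeal [Finite ι] (σ : PartialCharacter k ι) :
    σ.latticeIdeal.map (MvPolynomial.map (algebraMap k K)) = (σ.baseChange K).latticeIdeal := by
  rw [PartialCharacter.latticeIdeal, PartialCharacter.latticeIdeal, Ideal.map_span]
  congr 1
  ext f
  constructor
  · rintro ⟨_, ⟨m, rfl⟩, rfl⟩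
    refine ⟨m, ?_⟩
    rw [map_sub, map_mul, map_C, map_posMonomial, map_posMonomial]
    rfl
  · rintro ⟨m, rfl⟩
    refine ⟨_, ⟨m, rfl⟩, ?_⟩
    rw [map_sub, map_mul, map_C, map_posMonomial, map_posMonomial]
    rfl

theorem map_cellIdeal [Finite ι] (𝓔 : Set ι) (σ : PartialCharacter k 𝓔) :
    (cellIdeal 𝓔 σ).map (MvPolynomial.map (algebraMap k K)) = cellIdeal 𝓔 (σ.baseChange K) := by
  rw [cellIdeal, cellIdeal, Ideal.map_sup]
  congr 1
  · rw [nonCellIdeal, nonCellIdeal, Ideal.map_span]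
    congr 1
    ext f
    constructor
    · rintro ⟨_, ⟨i, hi, rfl⟩, rfl⟩
      exact ⟨i, hi, map_X _ _⟩
    · rintro ⟨i, hi, rfl⟩
      exact ⟨X i, ⟨i, hi, rfl⟩, map_X _ _⟩
  · have h : (MvPolynomial.map (algebraMap k K)).comp
        (rename ((↑) : 𝓔 → ι) : MvPolynomial 𝓔 k →ₐ[k] _).toRingHom =
        (rename ((↑) : 𝓔 → ι) : MvPolynomial 𝓔 K →ₐ[K] _).toRingHom.comp
          (MvPolynomial.map (algebraMap k K)) := RingHom.ext fun f => map_rename _ _ f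
    rw [← map_latticeIdeal]
    have := congrArg (fun φ => σ.latticeIdeal.map φ) h
    rwa [← Ideal.map_map, ← Ideal.map_map] at this

/-- Apply a linear form to the coefficients of a polynomial. -/
noncomputable def coeffForm (l : K →ₗ[k] k) (f : MvPolynomial ι K) : MvPolynomial ι k :=
  ∑ u ∈ f.support, monomial u (l (f.coeff u))

variable {K}

theorem coeff_coeffForm (l : K →ₗ[k] k) (f : MvPolynomial ι K) (u : ι →₀ ℕ) :
    (coeffForm K l f).coeff u = l (f.coeff u) := by
  classical
  rw [coeffForm, coeff_sum]
  simp only [coeff_monomial, Finset.sum_ite_eq']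
  split_ifs with h
  · rfl
  · rw [notMem_support_iff.1 h, map_zero]

theorem coeffForm_add (l : K →ₗ[k] k) (f g : MvPolynomial ι K) :
    coeffForm K l (f + g) = coeffForm K l f + coeffForm K l g := by
  ext u
  rw [coeff_add, coeff_coeffForm, coeff_coeffForm, coeff_coeffForm, coeff_add, map_add]

theorem coeffForm_mem {J : Ideal (MvPolynomial ι k)} {f : MvPolynomial ι K}
    (hf : f ∈ J.map (MvPolynomial.map (algebraMap k K))) (l : K →ₗ[k] k) :
    coeffForm K l f ∈ J := by
  classical
  induction hf using Submodule.span_induction generalizing l with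
  | mem f hf =>
    obtain ⟨g, hg, rfl⟩ := hf
    have : coeffForm K l (MvPolynomial.map (algebraMap k K) g) = C (l 1) * g := by
      ext u
      rw [coeff_coeffForm, coeff_map, Algebra.algebraMap_eq_smul_one, map_smul, coeff_C_mul,
        smul_eq_mul, mul_comm]
    rw [this]
    exact J.mul_mem_left _ hg
  | zero => simp [coeffForm]
  | add x y _ _ hx hy =>
    rw [coeffForm_add]
    exact J.add_mem (hx l) (hy l)
  | smul p x _ hx =>
    rw [smul_eq_mul]
    induction p using MvPolynomial.induction_on' with
    | monomial w a =>
      -- The scalar `a ∈ K` is absorbed into the linear form, so the induction must range over all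
      -- `l`.
      have : coeffForm K l (monomial w a * x) =
          monomial w 1 * coeffForm K (l.comp (LinearMap.mulLeft k a)) x := by
        ext u
        rw [coeff_coeffForm, coeff_monomial_mul', coeff_monomial_mul']
        split_ifs
        · rw [coeff_coeffForm, one_mul]
          rfl
        · exact map_zero l
      rw [this]
      exact J.mul_mem_left _ (hx _)
    | add p q hp hq =>
      rw [add_mul, coeffForm_add]
      exact J.add_mem hp hq

theorem eq_sum_coeffForm {κ : Type*} (b : Module.Basis κ k K) (f : MvPolynomial ι K) :
    ∃ s : Finset κ, f = ∑ j ∈ s, C (b j) *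
      MvPolynomial.map (algebraMap k K) (coeffForm K (b.coord j) f) := by
  classical
  refine ⟨f.support.biUnion fun u => (b.repr (f.coeff u)).support, ?_⟩
  ext u
  rw [coeff_sum]
  simp only [coeff_C_mul, coeff_map, coeff_coeffForm]
  by_cases hu : u ∈ f.support
  · conv_lhs => rw [← b.linearCombination_repr (f.coeff u), Finsupp.linearCombination_apply]
    rw [Finsupp.sum_of_support_subset _ (Finset.subset_biUnion_of_mem
      (fun u => (b.repr (f.coeff u)).support) hu) _ (by simp)]
    refine Finset.sum_congr rfl fun j _ => ?_
    rw [Algebra.smul_def, mul_comm]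
    rfl
  · simp [notMem_support_iff.1 hu]

/-- Coordinates with respect to a `k`-basis of `K` stay in each `J_i` and reassemble `f`. -/
theorem map_inf_map (J₁ J₂ : Ideal (MvPolynomial ι k)) :
    (J₁ ⊓ J₂).map (MvPolynomial.map (algebraMap k K)) =
      J₁.map (MvPolynomial.map (algebraMap k K)) ⊓ J₂.map (MvPolynomial.map (algebraMap k K)) := by
  refine le_antisymm (Ideal.map_inf_le _) fun f ⟨h₁, h₂⟩ => ?_
  obtain ⟨s, hs⟩ := eq_sum_coeffForm (Module.Basis.ofVectorSpace k K) f
  rw [hs]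
  exact Ideal.sum_mem _ fun j _ => Ideal.mul_mem_left _ _
    (Ideal.mem_map_of_mem _ ⟨coeffForm_mem h₁ _, coeffForm_mem h₂ _⟩)

end BaseChange

/-! ### Radicals of cellular ideals. -/

section Cellular

variable {ι k : Type*} [Field k]

theorem IsNonzerodivisorVar.mem_of_X_mul_mem {J : Ideal (MvPolynomial ι k)} {i : ι}
    (h : IsNonzerodivisorVar J i) {f : MvPolynomial ι k} (hf : X i * f ∈ J) : f ∈ J := by
  rw [← Ideal.Quotient.eq_zero_iff_mem] at hf ⊢
  rw [map_mul] at hf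
  exact (mul_left_mem_nonZeroDivisors_eq_zero_iff h).1 hf

theorem isNilpotentVar_iff {J : Ideal (MvPolynomial ι k)} {i : ι} :
    IsNilpotentVar J i ↔ X i ∈ J.radical := by
  refine exists_congr fun n => ?_
  rw [← map_pow, Ideal.Quotient.eq_zero_iff_mem]

theorem mem_restrictTo_of_X_mul_mem {J : Ideal (MvPolynomial ι k)} (i : cellIndices J)
    {f : MvPolynomial (cellIndices J) k} (hf : X i * f ∈ restrictTo (cellIndices J) J) :
    f ∈ restrictTo (cellIndices J) J := by
  refine i.2.mem_of_X_mul_mem (J := J) ?_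
  have : rename ((↑) : cellIndices J → ι) (X i * f) ∈ J := hf
  rwa [map_mul, rename_X] at this

theorem eq_zero_of_monomial_mapDomain_mem_radical {J : Ideal (MvPolynomial ι k)} (hJ : J ≠ ⊤)
    (u : cellIndices J →₀ ℕ) {a : k} (h : monomial (u.mapDomain (↑)) a ∈ J.radical) : a = 0 := by
  obtain ⟨n, hn⟩ := h
  by_contra ha
  rw [← rename_monomial, ← map_pow, monomial_pow] at hn
  have h1 : monomial (n • u) 1 * C (a ^ n) ∈ restrictTo (cellIndices J) J := by
    rw [mul_comm, C_mul_monomial, mul_one]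
    exact hn
  have h2 := Ideal.mul_mem_right (C (a ^ n)⁻¹) _
    (monomial_mul_mem_cancel (fun i f => mem_restrictTo_of_X_mul_mem i) _ h1)
  rw [← C_mul, mul_inv_cancel₀ (pow_ne_zero n ha), C_1] at h2
  exact Ideal.comap_ne_top (rename ((↑) : cellIndices J → ι)) hJ ((Ideal.eq_top_iff_one _).2 h2)

theorem IsCellular.monomial_mem_radical {J : Ideal (MvPolynomial ι k)} (hJ : IsCellular J)
    {u : ι →₀ ℕ} (hu : ¬ ↑u.support ⊆ Set.range ((↑) : cellIndices J → ι)) (a : k) :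
    monomial u a ∈ J.radical := by
  obtain ⟨i, hi, hiE⟩ := Set.not_subset.1 hu
  rw [Subtype.range_coe] at hiE
  have hi' : X i ∈ J.radical := isNilpotentVar_iff.1 ((hJ.cell i).resolve_left hiE)
  have hle : Finsupp.single i 1 ≤ u := by
    rw [Finsupp.single_le_iff]
    exact Nat.one_le_iff_ne_zero.2 (Finsupp.mem_support_iff.1 hi)
  have : monomial u a = monomial (u - Finsupp.single i 1) a * X i := by
    rw [X, monomial_mul, mul_one, tsub_add_cancel_of_le hle]
  rw [this]
  exact Ideal.mul_mem_left _ _ hi'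

variable [Finite ι]

theorem IsCellular.exists_restrictTo_eq {J : Ideal (MvPolynomial ι k)} (hJ : IsCellular J) :
    ∃ σ : PartialCharacter k (cellIndices J), restrictTo (cellIndices J) J = σ.latticeIdeal := by
  refine exists_eq_latticeIdeal (hJ.binomial.restrictTo _) ?_ fun i f =>
    mem_restrictTo_of_X_mul_mem i
  exact Ideal.comap_ne_top _ hJ.ne_top

theorem IsCellular.cellIdeal_le_radical {J : Ideal (MvPolynomial ι k)} (hJ : IsCellular J)
    {σ : PartialCharacter k (cellIndices J)}
    (hσ : restrictTo (cellIndices J) J = σ.latticeIdeal) :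
    cellIdeal (cellIndices J) σ ≤ J.radical := by
  refine sup_le (Ideal.span_le.2 ?_) ?_
  · rintro _ ⟨i, hi, rfl⟩
    exact isNilpotentVar_iff.1 ((hJ.cell i).resolve_left hi)
  · rw [← hσ]
    exact Ideal.map_comap_le.trans Ideal.le_radical

/-- Only binomials need checking. If both monomials lie in `k[𝓔]`, the binomial is in `I₊(σ)`; if
neither does, it is in `M(𝓔)`. In the mixed case the monomial from `k[𝓔]` would be nilpotent modulo
`J`, so its coefficient is zero. -/
theorem IsCellular.le_cellIdeal {J : Ideal (MvPolynomial ι k)} (hJ : IsCellular J)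
    {σ : PartialCharacter k (cellIndices J)}
    (hσ : restrictTo (cellIndices J) J = σ.latticeIdeal) :
    J ≤ cellIdeal (cellIndices J) σ := by
  have hsub : ∀ u : ι →₀ ℕ, ((u.support : Set ι) ⊆ Set.range (Subtype.val : cellIndices J → ι)) →
      ∃ u' : cellIndices J →₀ ℕ, u = u'.mapDomain Subtype.val := fun u hu => by
    obtain ⟨u', hu'⟩ := (Finsupp.mem_range_mapDomain_iff _ Subtype.val_injective u).2 fun i hi => by
      by_contra h
      exact hi (hu (Finsupp.mem_support_iff.2 h))
    exact ⟨u', hu'.symm⟩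
  refine hJ.binomial.le fun u v c h => mem_cellIdeal.2 ?_
  rw [map_sub]
  by_cases hu : ↑u.support ⊆ Set.range ((↑) : cellIndices J → ι) <;>
    by_cases hv : ↑v.support ⊆ Set.range ((↑) : cellIndices J → ι)
  · obtain ⟨u, rfl⟩ := hsub u hu
    obtain ⟨v, rfl⟩ := hsub v hv
    rw [killCompl_monomial_mapDomain, killCompl_monomial_mapDomain, ← hσ]
    change rename ((↑) : cellIndices J → ι) _ ∈ J
    rwa [map_sub, rename_monomial, rename_monomial]
  · obtain ⟨u, rfl⟩ := hsub u hu
    have := add_mem (Ideal.le_radical h) (hJ.monomial_mem_radical hv c)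
    rw [sub_add_cancel] at this
    exact absurd (eq_zero_of_monomial_mapDomain_mem_radical hJ.ne_top u this) one_ne_zero
  · obtain ⟨v, rfl⟩ := hsub v hv
    have := sub_mem (hJ.monomial_mem_radical hu 1) (Ideal.le_radical h)
    rw [sub_sub_cancel] at this
    rw [eq_zero_of_monomial_mapDomain_mem_radical hJ.ne_top v this,
      killCompl_monomial_eq_zero_of_not_subset _ _ hu]
    simp
  · rw [killCompl_monomial_eq_zero_of_not_subset _ _ hu,
      killCompl_monomial_eq_zero_of_not_subset _ _ hv, sub_zero]
    exact zero_mem _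

theorem isRadical_cellIdeal [CharZero k] (𝓔 : Set ι) (σ : PartialCharacter k 𝓔) :
    (cellIdeal 𝓔 σ).IsRadical := by
  rintro f ⟨n, hf⟩
  rw [← map_mem_cellIdeal_baseChange (AlgebraicClosure k)] at hf ⊢
  rw [map_pow] at hf
  exact isRadical_cellIdeal_of_isAlgClosed 𝓔 (σ.baseChange (AlgebraicClosure k)) ⟨n, hf⟩

theorem IsCellular.radical_eq [CharZero k] {J : Ideal (MvPolynomial ι k)} (hJ : IsCellular J)
    {σ : PartialCharacter k (cellIndices J)}
    (hσ : restrictTo (cellIndices J) J = σ.latticeIdeal) :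
    J.radical = cellIdeal (cellIndices J) σ :=
  le_antisymm ((isRadical_cellIdeal _ σ).radical_le_iff.2 (hJ.le_cellIdeal hσ))
    (hJ.cellIdeal_le_radical hσ)

end Cellular

/-! ### Splitting along a variable. -/

section Splitting

variable {ι k : Type*} [Field k]

theorem isNonzerodivisorVar_of_forall {J : Ideal (MvPolynomial ι k)} {i : ι}
    (h : ∀ f, X i * f ∈ J → f ∈ J) : IsNonzerodivisorVar J i := by
  unfold IsNonzerodivisorVar
  rw [mem_nonZeroDivisors_iff_right]
  intro y hy
  obtain ⟨f, rfl⟩ := Ideal.Quotient.mk_surjective y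
  rw [← map_mul, Ideal.Quotient.eq_zero_iff_mem] at hy
  exact Ideal.Quotient.eq_zero_iff_mem.2 (h f (by rwa [mul_comm]))

theorem le_saturation (J : Ideal (MvPolynomial ι k)) (f : MvPolynomial ι k) :
    J ≤ saturation J f := fun g hg => mem_saturation.2 ⟨0, by simpa using hg⟩

theorem lt_sup_span_X {J : Ideal (MvPolynomial ι k)} {i : ι} (h : ¬ IsNilpotentVar J i) :
    J < J ⊔ Ideal.span {X i} := by
  refine lt_of_le_of_ne le_sup_left fun heq => h (isNilpotentVar_iff.2 (Ideal.le_radical ?_))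
  rw [heq]
  exact Ideal.mem_sup_right (Ideal.mem_span_singleton_self _)

theorem lt_saturation_X {J : Ideal (MvPolynomial ι k)} {i : ι} (h : ¬ IsNonzerodivisorVar J i) :
    J < saturation J (X i) := by
  refine lt_of_le_of_ne (le_saturation _ _) fun heq => h (isNonzerodivisorVar_of_forall ?_)
  intro f hf
  rw [heq]
  exact mem_saturation.2 ⟨1, by rwa [pow_one, mul_comm]⟩

/-- Otherwise `x_i` would be a unit modulo `J`, hence a nonzerodivisor. -/
theorem sup_span_X_ne_top {J : Ideal (MvPolynomial ι k)} {i : ι}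
    (h : ¬ IsNonzerodivisorVar J i) : J ⊔ Ideal.span {X i} ≠ ⊤ := by
  refine fun htop => h (isNonzerodivisorVar_of_forall fun f hf => ?_)
  obtain ⟨j, hj, y, hy, hjy⟩ := Submodule.mem_sup.1 ((Ideal.eq_top_iff_one _).1 htop)
  obtain ⟨g, rfl⟩ := Ideal.mem_span_singleton'.1 hy
  have : f = f * j + g * (X i * f) := by linear_combination -f * hjy
  rw [this]
  exact J.add_mem (J.mul_mem_left _ hj) (J.mul_mem_left _ hf)

theorem saturation_X_ne_top {J : Ideal (MvPolynomial ι k)} {i : ι} (h : ¬ IsNilpotentVar J i) :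
    saturation J (X i) ≠ ⊤ := by
  intro htop
  obtain ⟨s, hs⟩ := mem_saturation.1 ((Ideal.eq_top_iff_one _).1 htop)
  exact h (isNilpotentVar_iff.2 ⟨s, by rwa [one_mul] at hs⟩)

theorem le_iff_of_isPrime {P : Ideal (MvPolynomial ι k)} (hP : P.IsPrime)
    (J : Ideal (MvPolynomial ι k)) (i : ι) :
    J ≤ P ↔ J ⊔ Ideal.span {X i} ≤ P ∨ saturation J (X i) ≤ P := by
  refine ⟨fun h => ?_, ?_⟩
  · by_cases hi : X i ∈ P
    · exact Or.inl (sup_le h (Ideal.span_le.2 (by simpa using hi)))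
    · right
      rintro g ⟨s, hs⟩
      exact (hP.mem_or_mem (h hs)).resolve_right fun h' => hi (hP.mem_of_pow_mem s h')
  · rintro (h | h)
    · exact le_sup_left.trans h
    · exact (le_saturation _ _).trans h

theorem radical_eq_inf (J : Ideal (MvPolynomial ι k)) (i : ι) :
    J.radical = (J ⊔ Ideal.span {X i}).radical ⊓ (saturation J (X i)).radical := by
  refine le_antisymm (le_inf (Ideal.radical_mono le_sup_left)
    (Ideal.radical_mono (le_saturation _ _))) ?_
  rw [Ideal.radical_eq_sInf J]
  refine le_sInf fun P ⟨hJP, hP⟩ => ?_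
  rcases (le_iff_of_isPrime hP J i).1 hJP with h | h
  · exact inf_le_left.trans (hP.radical_le_iff.2 h)
  · exact inf_le_right.trans (hP.radical_le_iff.2 h)

theorem exists_of_not_isCellular {J : Ideal (MvPolynomial ι k)} (hJ : IsBinomialIdeal J)
    (hne : J ≠ ⊤) (h : ¬ IsCellular J) : ∃ i, ¬ IsNonzerodivisorVar J i ∧ ¬ IsNilpotentVar J i := by
  by_contra! hcon
  exact h ⟨hJ, hne, fun i => or_iff_not_imp_left.2 (hcon i)⟩

/-- Noetherian induction along the splittings: `Rad(J)` is the intersection of the radicals of two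
larger ideals, and extension to `K` preserves this. Cellular ideals are the base case. -/
theorem isRadical_map_radical [Finite ι] [CharZero k] (K : Type*) [Field K] [Algebra k K]
    [IsAlgClosed K] {J : Ideal (MvPolynomial ι k)} (hJ : IsBinomialIdeal J) (hne : J ≠ ⊤) :
    (J.radical.map (MvPolynomial.map (algebraMap k K))).IsRadical := by
  have : CharZero K := charZero_of_injective_algebraMap (algebraMap k K).injective
  induction J using WellFoundedGT.induction with
  | ind J ih =>
    by_cases hc : IsCellular J
    · obtain ⟨σ, hσ⟩ := hc.exists_restrictTo_eq
      rw [hc.radical_eq hσ, map_cellIdeal]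
      exact isRadical_cellIdeal_of_isAlgClosed _ _
    · obtain ⟨i, hzd, hnil⟩ := exists_of_not_isCellular hJ hne hc
      rw [radical_eq_inf J i, map_inf_map]
      exact (ih _ (lt_sup_span_X hnil) (hJ.sup_span_X i) (sup_span_X_ne_top hzd)).inf
        (ih _ (lt_saturation_X hzd) (hJ.saturation_X i) (saturation_X_ne_top hnil))

end Splitting

/-! ### Termination and invariants of runs. -/

section Runs

variable {k K : Type*} [Field k] [Field K] {n : ℕ}

/-- The saved ideals are finitely many binomial primes. -/
def State.CollectedPrime (s : State k K n) : Prop :=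
  s.collected.Finite ∧ ∀ P ∈ s.collected, P.IsPrime ∧ IsBinomialIdeal P

/-- A prime containing a finite intersection contains one of its members, and distinct output ideals
are incomparable. -/
theorem State.CollectedPrime.sInf_output_diff_ne {s : State k K n} (hs : s.CollectedPrime)
    {P : Ideal (MvPolynomial (Fin n) K)} (hP : P ∈ s.output) :
    sInf (s.output \ {P}) ≠ sInf s.output := by
  intro heq
  have hfin : (s.output \ {P}).Finite := hs.1.subset fun Q hQ => hQ.1.1
  have hle : sInf (s.output \ {P}) ≤ P := heq ▸ sInf_le hP
  rw [← hfin.coe_toFinset, ← Finset.inf_id_eq_sInf] at hle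
  obtain ⟨Q, hQ, hQP⟩ := (hs.2 P hP.1).1.inf_le'.1 hle
  obtain ⟨hQ, hne⟩ := hfin.mem_toFinset.1 hQ
  exact hne (hP.2 Q hQ.1 hQP)

variable [Algebra k K]

theorem Step.cutExpand {s t : State k K n} (h : Step s t) :
    Relation.CutExpand (fun J J' => J > J') t.pending s.pending := by
  cases h with
  | cellular J W S σ hJ hσ => exact ⟨0, J, by simp, by rw [add_comm, Multiset.singleton_add]; simp⟩
  | split J W S i hJ hzd hnil =>
    refine ⟨{J ⊔ Ideal.span {X i}, saturation J (X i)}, J, ?_, ?_⟩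
    · intro J' hJ'
      simp only [Multiset.insert_eq_cons, Multiset.mem_cons, Multiset.mem_singleton] at hJ'
      rcases hJ' with rfl | rfl
      · exact lt_sup_span_X hnil
      · exact lt_saturation_X hzd
    · simp only [Multiset.insert_eq_cons, ← Multiset.singleton_add]
      abel

theorem not_exists_infinite_run :
    ¬ ∃ r : ℕ → State k K n, ∀ j, Step (r j) (r (j + 1)) := by
  rintro ⟨r, hr⟩
  have hwf : WellFounded (Relation.CutExpand
      (fun J J' : Ideal (MvPolynomial (Fin n) k) => J > J')) := wellFounded_gt.cutExpand
  exact (wellFounded_iff_isEmpty_descending_chain.1 hwf).false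
    ⟨fun j => (r j).pending, fun j => (hr j).cutExpand⟩

/-- All pending ideals are proper binomial ideals. -/
def State.PendingProper (s : State k K n) : Prop :=
  ∀ J ∈ s.pending, IsBinomialIdeal J ∧ J ≠ ⊤

theorem Step.pendingProper {s t : State k K n} (h : Step s t) (hs : s.PendingProper) :
    t.PendingProper := by
  cases h with
  | cellular J W S σ hJ hσ => exact fun J' hJ' => hs J' (Multiset.mem_cons_of_mem hJ')
  | split J W S i hJ hzd hnil =>
    intro J' hJ'
    have hJb := (hs J (Multiset.mem_cons_self _ _)).1
    simp only [Multiset.mem_cons] at hJ'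
    rcases hJ' with rfl | rfl | hJ'
    · exact ⟨hJb.sup_span_X i, sup_span_X_ne_top hzd⟩
    · exact ⟨hJb.saturation_X i, saturation_X_ne_top hnil⟩
    · exact hs J' (Multiset.mem_cons_of_mem hJ')

theorem Step.collectedPrime [IsAlgClosed K] {s t : State k K n} (h : Step s t)
    (hs : s.CollectedPrime) : t.CollectedPrime := by
  cases h with
  | cellular J W S σ hJ hσ =>
    refine ⟨hs.1.union ?_, ?_⟩
    · refine ((σ.baseChange K).finite_setOf_isSaturationOf.image (cellIdeal _)).subset ?_
      rintro _ ⟨τ, hτ, rfl⟩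
      exact ⟨τ, hτ, rfl⟩
    · rintro _ (hP | ⟨τ, hτ, rfl⟩)
      · exact hs.2 _ hP
      · exact ⟨isPrime_cellIdeal hτ, isBinomialIdeal_cellIdeal _ _⟩
  | split J W S i hJ hzd hnil => exact hs

/-- The prime `P` contains the extension of a pending ideal or a saved ideal. -/
def State.Covers (s : State k K n) (P : Ideal (MvPolynomial (Fin n) K)) : Prop :=
  (∃ J ∈ s.pending, J ≤ P.comap (MvPolynomial.map (algebraMap k K))) ∨ ∃ Q ∈ s.collected, Q ≤ P

/-- A prime contains `J` iff it contains `Rad(J)`, which for cellular `J` extends to `M(𝓔) + I₊(σ)`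
over `K`, and so iff it contains some `P(τ)`. -/
theorem Step.covers_iff [CharZero k] [IsAlgClosed K] {s t : State k K n} (h : Step s t)
    {P : Ideal (MvPolynomial (Fin n) K)} (hP : P.IsPrime) : s.Covers P ↔ t.Covers P := by
  have : CharZero K := charZero_of_injective_algebraMap (algebraMap k K).injective
  have hP' : (P.comap (MvPolynomial.map (algebraMap k K))).IsPrime := Ideal.comap_isPrime _ _
  cases h with
  | cellular J W S σ hJ hσ =>
    have key : J ≤ P.comap (MvPolynomial.map (algebraMap k K)) ↔
        ∃ Q ∈ {Q | ∃ τ : PartialCharacter K (cellIndices J),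
          τ.IsSaturationOf (σ.baseChange K) ∧ Q = cellIdeal (cellIndices J) τ}, Q ≤ P := by
      rw [← hP'.radical_le_iff, hJ.radical_eq hσ, ← Ideal.map_le_iff_le_comap, map_cellIdeal]
      constructor
      · intro h
        obtain ⟨τ, hτ, hle⟩ := exists_cellIdeal_le_of_isPrime hP h
        exact ⟨_, ⟨τ, hτ, rfl⟩, hle⟩
      · rintro ⟨_, ⟨τ, hτ, rfl⟩, hle⟩
        exact (cellIdeal_le_cellIdeal hτ).trans hle
    simp only [State.Covers, Multiset.mem_cons, Set.mem_union, or_and_right, exists_or,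
      exists_eq_left, key]
    exact or_assoc.trans (or_comm.trans or_assoc)
  | split J W S i hJ hzd hnil =>
    simp only [State.Covers, Multiset.mem_cons, or_and_right, exists_or, exists_eq_left,
      le_iff_of_isPrime hP' J i]
    exact or_congr or_assoc Iff.rfl

variable {I : Ideal (MvPolynomial (Fin n) k)} {s : State k K n}

theorem Reachable.pendingProper (h : Reachable I s) (hI : IsBinomialIdeal I) (hne : I ≠ ⊤) :
    s.PendingProper := by
  unfold Reachable at h
  induction h with
  | refl =>
    intro J hJ
    rw [initial, Multiset.mem_singleton] at hJ
    rw [hJ]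
    exact ⟨hI, hne⟩
  | tail _ hst ih => exact hst.pendingProper ih

theorem Reachable.collectedPrime [IsAlgClosed K] (h : Reachable I s) : s.CollectedPrime := by
  unfold Reachable at h
  induction h with
  | refl => exact ⟨Set.finite_empty, fun P hP => absurd hP (Set.notMem_empty P)⟩
  | tail _ hst ih => exact hst.collectedPrime ih

theorem Reachable.map_le_iff [CharZero k] [IsAlgClosed K] (h : Reachable I s)
    {P : Ideal (MvPolynomial (Fin n) K)} (hP : P.IsPrime) :
    I.map (MvPolynomial.map (algebraMap k K)) ≤ P ↔ s.Covers P := by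
  unfold Reachable at h
  induction h with
  | refl => simp [State.Covers, initial, Ideal.map_le_iff_le_comap]
  | tail _ hst ih => exact ih.trans (hst.covers_iff hP)

theorem exists_step (hs : s.PendingProper) (hne : s.pending ≠ 0) : ∃ t, Step s t := by
  obtain ⟨pending, S⟩ := s
  obtain ⟨J, hJ⟩ := Multiset.exists_mem_of_ne_zero hne
  obtain ⟨W, rfl⟩ := Multiset.exists_cons_of_mem hJ
  by_cases hc : IsCellular J
  · obtain ⟨σ, hσ⟩ := hc.exists_restrictTo_eq
    exact ⟨_, Step.cellular J W S σ hc hσ⟩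
  · obtain ⟨i, hzd, hnil⟩ := exists_of_not_isCellular (hs J hJ).1 (hs J hJ).2 hc
    exact ⟨_, Step.split J W S i hc hzd hnil⟩

/-- With nothing pending, the primes over `I K[x]` are those over a saved ideal. As saved ideals are
themselves prime, the minimal ones are the minimal primes. -/
theorem Reachable.output_eq_minimalPrimes [CharZero k] [IsAlgClosed K] (h : Reachable I s)
    (h0 : s.pending = 0) :
    s.output = (I.map (MvPolynomial.map (algebraMap k K))).minimalPrimes := by
  have hcov : ∀ {P : Ideal (MvPolynomial (Fin n) K)}, P.IsPrime →
      (I.map (MvPolynomial.map (algebraMap k K)) ≤ P ↔ ∃ Q ∈ s.collected, Q ≤ P) := by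
    intro P hP
    rw [h.map_le_iff hP, State.Covers, h0]
    simp
  have hprime := h.collectedPrime.2
  ext P
  constructor
  · rintro ⟨hP, hmin⟩
    refine ⟨⟨(hprime P hP).1, (hcov (hprime P hP).1).2 ⟨P, hP, le_rfl⟩⟩, ?_⟩
    rintro q ⟨hq, hIq⟩ hqP
    obtain ⟨Q, hQ, hQq⟩ := (hcov hq).1 hIq
    rwa [← hmin Q hQ (hQq.trans hqP)]
  · rintro ⟨⟨hP, hIP⟩, hmin⟩
    have hle : ∀ Q ∈ s.collected, Q ≤ P → Q = P := fun Q hQ hQP =>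
      le_antisymm hQP (hmin ⟨(hprime Q hQ).1, (hcov (hprime Q hQ).1).2 ⟨Q, hQ, le_rfl⟩⟩ hQP)
    obtain ⟨Q, hQ, hQP⟩ := (hcov hP).1 hIP
    exact ⟨hle Q hQ hQP ▸ hQ, hle⟩

end Runs

end BinomialMinPrimes

open BinomialMinPrimes in
theorem mainTheorem3 {k K : Type*} [Field k] [CharZero k] [Field K] [Algebra k K] [IsAlgClosed K]
    {n : ℕ} (I : Ideal (MvPolynomial (Fin n) k)) (hI : IsBinomialIdeal I) (hI_ne : I ≠ ⊤) :
    -- termination: whatever the choices made, there is no infinite run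
    (¬ ∃ r : ℕ → State k K n, r 0 = initial K I ∧ ∀ j, Step (r j) (r (j + 1))) ∧
    -- a run stops only when no ideal is pending
    (∀ s : State k K n, Reachable I s → s.pending ≠ 0 → ∃ t, Step s t) ∧
    -- every step is well defined
    (∀ s : State k K n, Reachable I s → ∀ J ∈ s.pending,
      IsBinomialIdeal J ∧ J ≠ ⊤ ∧
      (¬ IsCellular J → ∃ i, ¬ IsNonzerodivisorVar J i ∧ ¬ IsNilpotentVar J i) ∧
      (IsCellular J → ∃ σ : PartialCharacter k (cellIndices J),
        restrictTo (cellIndices J) J = σ.latticeIdeal ∧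
        J.radical = cellIdeal (cellIndices J) σ ∧
        ∀ σ' : PartialCharacter k (cellIndices J),
          restrictTo (cellIndices J) J = σ'.latticeIdeal → σ' = σ)) ∧
    -- at each time finitely many ideals have been saved, all of them binomial primes
    (∀ s : State k K n, Reachable I s → s.collected.Finite ∧
      ∀ P ∈ s.collected, P.IsPrime ∧ IsBinomialIdeal P) ∧
    -- correctness: the output of every completed run is the set of minimal primes, and this is
    -- an irredundant prime decomposition of the radical
    (∀ s : State k K n, Reachable I s → s.pending = 0 →
      s.output = (I.map (MvPolynomial.map (algebraMap k K))).minimalPrimes ∧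
      (I.map (MvPolynomial.map (algebraMap k K))).radical = sInf s.output ∧
      I.radical.map (MvPolynomial.map (algebraMap k K)) = sInf s.output ∧
      ∀ P ∈ s.output, sInf (s.output \ {P}) ≠ sInf s.output) := by
  refine ⟨fun ⟨r, _, hr⟩ => not_exists_infinite_run ⟨r, hr⟩,
    fun s hs h0 => exists_step (hs.pendingProper hI hI_ne) h0, fun s hs J hJ => ?_,
    fun s hs => hs.collectedPrime, fun s hs h0 => ?_⟩
  · obtain ⟨hJb, hJne⟩ := hs.pendingProper hI hI_ne J hJ
    refine ⟨hJb, hJne, exists_of_not_isCellular hJb hJne, fun hc => ?_⟩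
    obtain ⟨σ, hσ⟩ := hc.exists_restrictTo_eq
    exact ⟨σ, hσ, hc.radical_eq hσ, fun σ' hσ' =>
      PartialCharacter.latticeIdeal_injective (hσ'.symm.trans hσ)⟩
  · have hout := hs.output_eq_minimalPrimes h0
    have hrad : (I.map (MvPolynomial.map (algebraMap k K))).radical = sInf s.output := by
      rw [hout, Ideal.sInf_minimalPrimes]
    refine ⟨hout, hrad, ?_, fun P hP => hs.collectedPrime.sInf_output_diff_ne hP⟩
    rw [← hrad]
    refine le_antisymm (Ideal.map_radical_le _) ?_
    -- `Rad(I) K[x]` is radical and contains `I K[x]`, hence contains its radical.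
    exact (isRadical_map_radical K hI hI_ne).radical_le_iff.2 (Ideal.map_mono Ideal.le_radical)
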